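/- Let $\Bbbk$ be a field; all bialgebras are over $\Bbbk$, $\otimes=\otimes_\Bbbk$, $\tau$ is the flip, and $T^{\mathrm{op}}=\tau(T)$ for $T\in H\otimes H$. A triangular bialgebra $(H,\mathcal R)$ is a bialgebra $H$ with an invertible $\mathcal R\in H\otimes H$ such that $\Delta^{\mathrm{op}}(x)=\mathcal R\Delta(x)\mathcal R^{-1}$ for all $x\in H$, $(\mathrm{Id}\otimes\Delta)(\mathcal R)=\mathcal R_{13}\mathcal R_{12}$, $(\Delta\otimes\mathrm{Id})(\mathcal R)=\mathcal R_{13}\mathcal R_{23}$ and $\mathcal R^{-1}=\mathcal R^{\mathrm{op}}$. Let $\mathsf{Tr}$ be the category of triangular bialgebras, whose morphisms $(H,\mathcal R)\to(H',\mathcal R')$ are the bialgebra maps $f:H\to H'$ with $(f\otimes f)(\mathcal R)=\mathcal R'$. A twist on a bialgebra $H$ is an invertible $\mathcal F\in H\otimes H$ with $(\mathcal F\otimes1)(\Delta\otimes\mathrm{Id})(\mathcal F)=(1\otimes\mathcal F)(\mathrm{Id}\otimes\Delta)(\mathcal F)$ and $(\varepsilon\otimes\mathrm{Id})(\mathcal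 F)=1=(\mathrm{Id}\otimes\varepsilon)(\mathcal F)$. Then $H_{\mathcal F}$ denotes the bialgebra with the same algebra and counit as $H$ and with comultiplication $\Delta_{\mathcal F}(x)=\mathcal F\Delta(x)\mathcal F^{-1}$, and one sets $\mathcal R_{\mathcal F}=\mathcal F^{\mathrm{op}}\mathcal R\mathcal F^{-1}$. A 1-cell $(f,\mathcal F):(H,\mathcal R)\to(H',\mathcal R')$ of $\mathsf{TwTr}$ is a twist $\mathcal F$ on $H'$ together with a morphism $f:(H,\mathcal R)\to(H'_{\mathcal F},\mathcal R'_{\mathcal F})$ in $\mathsf{Tr}$. Composition is $(f',\mathcal F')\circ(f,\mathcal F)=(f'f,\,(f'\otimes f')(\mathcal F)\mathcal F')$, identities are $(\mathrm{Id},1\otimes1)$, and a 1-cell is invertible if it has a two-sided inverse 1-cell. Put $(H_1,\mathcal R_1)\otimes(H_2,\mathcal R_2)=(H_1\otimes H_2,\widetilde{\mathcal R})$ with $\widetilde{\mathcal R}=(\mathrm{Id}\otimes\tau\otimes\mathrm{Id})(\mathcal R_1\otimes\mathcal R_2)$. The diagonal of two 1-cells $(f_i,\mathcal F_i):(H,\mathcal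 R)\to(H_i,\mathcal R_i)$, $i=1,2$, is $$\langle(f_1,\mathcal F_1),(f_2,\mathcal F_2)\rangle=\big((f_1\otimes f_2)\Delta_H,\ (1\otimes(f_2\otimes f_1)(\mathcal R^{-1})\otimes1)\,(\mathrm{Id}\otimes\tau\otimes\mathrm{Id})(\mathcal F_1\otimes\mathcal F_2)\big).$$ **Theorem.** The following are equivalent for a triangular bialgebra $(H,\mathcal R)$. 1. There are triangular bialgebras $(H_1,\mathcal R_1)$ and $(H_2,\mathcal R_2)$ and an invertible 1-cell $(f,\mathcal F):(H,\mathcal R)\to(H_1,\mathcal R_1)\otimes(H_2,\mathcal R_2)$ in $\mathsf{TwTr}$. 2. There are triangular bialgebras $(H_1,\mathcal R_1)$ and $(H_2,\mathcal R_2)$, twists $\mathcal F_i$ on $H_i$ and surjective morphisms $f_i:(H,\mathcal R)\to((H_i)_{\mathcal F_i},(\mathcal R_i)_{\mathcal F_i})$ in $\mathsf{Tr}$, $i=1,2$, such that the diagonal $\langle(f_1,\mathcal F_1),(f_2,\mathcal F_2)\rangle:(H,\mathcal R)\to(H_1,\mathcal R_1)\otimes(H_2,\mathcal R_2)$ is an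 invertible 1-cell in $\mathsf{TwTr}$. 3. There are triangular bialgebras $(H_1,\mathcal R_1)$ and $(H_2,\mathcal R_2)$ such that $(H,\mathcal R)$ is a twisted tensor product of them, i.e. there are a twist $\mathcal F$ on $H_1\otimes H_2$ and an isomorphism $f:(H,\mathcal R)\to((H_1\otimes H_2)_{\mathcal F},\widetilde{\mathcal R}_{\mathcal F})$ in $\mathsf{Tr}$. 4. There are bialgebras $H_1$ and $H_2$, twists $\mathcal F_i$ on $H_i$ and surjective bialgebra maps $f_i:H\to(H_i)_{\mathcal F_i}$, $i=1,2$, such that $\mathcal F=(1\otimes(f_2\otimes f_1)(\mathcal R^{-1})\otimes1)\,(\mathrm{Id}\otimes\tau\otimes\mathrm{Id})(\mathcal F_1\otimes\mathcal F_2)$ is a twist on $H_1\otimes H_2$ and $(f_1\otimes f_2)\Delta:H\to(H_1\otimes H_2)_{\mathcal F}$ is a bialgebra isomorphism. Moreover, the equivalence holds factor by factor: for given bialgebras $H_1,H_2$, the four conditions with these $H_1,H_2$ (and the remaining data existentially quantified) are equivalent; and for given triangular bialgebras $(H_1,\mathcal R_1),(H_2,\mathcal R_2)$, conditions 1, 2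 and 3 with these triangular bialgebras are equivalent. -/

import Mathlib

open scoped TensorProduct

universe u v

noncomputable section

namespace TwTr

variable {k : Type u} [Field k]

/-! ### Triangular structures and twists -/

section Bialg

variable {H : Type*} [Ring H] [Bialgebra k H]

/-- `T ↦ T^op`, the flip of the two tensor factors, on invertible elements. -/
def opUnit (T : (H ⊗[k] H)ˣ) : (H ⊗[k] H)ˣ :=
  Units.map (Algebra.TensorProduct.comm k H H : H ⊗[k] H →* H ⊗[k] H) T

/-- `R` is a triangular structure on the bialgebra `H`. The first hexagon equation is written in
`H ⊗ (H ⊗ H)`, the second one in `(H ⊗ H) ⊗ H`. -/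
structure IsTriangular (R : (H ⊗[k] H)ˣ) : Prop where
  /-- `Δ^op(x) = R Δ(x) R⁻¹`. -/
  comul_op : ∀ x : H, Algebra.TensorProduct.comm k H H (Bialgebra.comulAlgHom k H x) =
    (R : H ⊗[k] H) * Bialgebra.comulAlgHom k H x * ((R⁻¹ : (H ⊗[k] H)ˣ) : H ⊗[k] H)
  /-- `(Id ⊗ Δ)(R) = R₁₃ R₁₂`. -/
  hexagon_right :
    Algebra.TensorProduct.map (AlgHom.id k H) (Bialgebra.comulAlgHom k H) (R : H ⊗[k] H) =
      Algebra.TensorProduct.map (AlgHom.id k H)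
          (Algebra.TensorProduct.includeRight : H →ₐ[k] H ⊗[k] H) (R : H ⊗[k] H) *
        Algebra.TensorProduct.map (AlgHom.id k H)
          (Algebra.TensorProduct.includeLeft : H →ₐ[k] H ⊗[k] H) (R : H ⊗[k] H)
  /-- `(Δ ⊗ Id)(R) = R₁₃ R₂₃`. -/
  hexagon_left :
    Algebra.TensorProduct.map (Bialgebra.comulAlgHom k H) (AlgHom.id k H) (R : H ⊗[k] H) =
      Algebra.TensorProduct.map (Algebra.TensorProduct.includeLeft : H →ₐ[k] H ⊗[k] H)
          (AlgHom.id k H) (R : H ⊗[k] H) *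
        Algebra.TensorProduct.map (Algebra.TensorProduct.includeRight : H →ₐ[k] H ⊗[k] H)
          (AlgHom.id k H) (R : H ⊗[k] H)
  /-- `R⁻¹ = R^op`. -/
  inv_eq_op : R⁻¹ = opUnit R

/-- `F` is a (Drinfeld) twist on the bialgebra `H`. -/
structure IsTwist (F : (H ⊗[k] H)ˣ) : Prop where
  /-- `(F ⊗ 1)(Δ ⊗ Id)(F) = (1 ⊗ F)(Id ⊗ Δ)(F)`. -/
  cocycle :
    Algebra.TensorProduct.assoc k k k H H H (((F : H ⊗[k] H) ⊗ₜ[k] (1 : H)) *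
        Algebra.TensorProduct.map (Bialgebra.comulAlgHom k H) (AlgHom.id k H) (F : H ⊗[k] H)) =
      ((1 : H) ⊗ₜ[k] (F : H ⊗[k] H)) *
        Algebra.TensorProduct.map (AlgHom.id k H) (Bialgebra.comulAlgHom k H) (F : H ⊗[k] H)
  /-- `(ε ⊗ Id)(F) = 1`. -/
  counit_left : Algebra.TensorProduct.lid k H
    (Algebra.TensorProduct.map (Bialgebra.counitAlgHom k H) (AlgHom.id k H) (F : H ⊗[k] H)) = 1
  /-- `(Id ⊗ ε)(F) = 1`. -/
  counit_right : Algebra.TensorProduct.rid k k H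
    (Algebra.TensorProduct.map (AlgHom.id k H) (Bialgebra.counitAlgHom k H) (F : H ⊗[k] H)) = 1

/-! ### The twisted bialgebra `H_F` -/

/-- `Δ_F(x) = F Δ(x) F⁻¹`. -/
def twistedComul (F : (H ⊗[k] H)ˣ) : H →ₐ[k] H ⊗[k] H :=
  AlgHom.ofLinearMap
    (LinearMap.mulLeft k (F : H ⊗[k] H) ∘ₗ
      LinearMap.mulRight k ((F⁻¹ : (H ⊗[k] H)ˣ) : H ⊗[k] H) ∘ₗ
      (Bialgebra.comulAlgHom k H).toLinearMap)
    (by simp)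
    (by intro x y; simp [mul_assoc])

theorem twistedComul_apply (F : (H ⊗[k] H)ˣ) (x : H) :
    twistedComul F x = (F : H ⊗[k] H) * Bialgebra.comulAlgHom k H x *
      ((F⁻¹ : (H ⊗[k] H)ˣ) : H ⊗[k] H) := by
  simp [twistedComul, mul_assoc]

theorem map_twistedComul_left (F : (H ⊗[k] H)ˣ) (y : H ⊗[k] H) :
    Algebra.TensorProduct.map (twistedComul F) (AlgHom.id k H) y =
      ((F : H ⊗[k] H) ⊗ₜ[k] (1 : H)) *
        Algebra.TensorProduct.map (Bialgebra.comulAlgHom k H) (AlgHom.id k H) y *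
        (((F⁻¹ : (H ⊗[k] H)ˣ) : H ⊗[k] H) ⊗ₜ[k] (1 : H)) := by
  induction y with
  | zero => simp
  | tmul a b => simp [twistedComul_apply]
  | add a b ha hb => simp only [map_add, mul_add, add_mul, ha, hb]

theorem map_twistedComul_right (F : (H ⊗[k] H)ˣ) (y : H ⊗[k] H) :
    Algebra.TensorProduct.map (AlgHom.id k H) (twistedComul F) y =
      ((1 : H) ⊗ₜ[k] (F : H ⊗[k] H)) *
        Algebra.TensorProduct.map (AlgHom.id k H) (Bialgebra.comulAlgHom k H) y *
        ((1 : H) ⊗ₜ[k] ((F⁻¹ : (H ⊗[k] H)ˣ) : H ⊗[k] H)) := by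
  induction y with
  | zero => simp
  | tmul a b => simp [twistedComul_apply]
  | add a b ha hb => simp only [map_add, mul_add, add_mul, ha, hb]

theorem IsTwist.coassoc {F : (H ⊗[k] H)ˣ} (hF : IsTwist F) (x : H) :
    Algebra.TensorProduct.assoc k k k H H H
        (Algebra.TensorProduct.map (twistedComul F) (AlgHom.id k H) (twistedComul F x)) =
      Algebra.TensorProduct.map (AlgHom.id k H) (twistedComul F) (twistedComul F x) := by
  set a := Algebra.TensorProduct.assoc k k k H H H
  set dl := Algebra.TensorProduct.map (Bialgebra.comulAlgHom k H) (AlgHom.id k H)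
  set dr := Algebra.TensorProduct.map (AlgHom.id k H) (Bialgebra.comulAlgHom k H)
  have hco : a (dl (Bialgebra.comulAlgHom k H x)) = dr (Bialgebra.comulAlgHom k H x) :=
    Coalgebra.coassoc_apply (R := k) x
  have hc : a ((F : H ⊗[k] H) ⊗ₜ[k] (1 : H)) * a (dl (F : H ⊗[k] H)) =
      ((1 : H) ⊗ₜ[k] (F : H ⊗[k] H)) * dr (F : H ⊗[k] H) := by
    rw [← map_mul]; exact hF.cocycle
  have h1 : (a (dl ((F⁻¹ : (H ⊗[k] H)ˣ) : H ⊗[k] H)) *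
        a (((F⁻¹ : (H ⊗[k] H)ˣ) : H ⊗[k] H) ⊗ₜ[k] (1 : H))) *
      (a ((F : H ⊗[k] H) ⊗ₜ[k] (1 : H)) * a (dl (F : H ⊗[k] H))) = 1 := by
    simp only [← map_mul]
    rw [mul_assoc, ← mul_assoc (_ ⊗ₜ _) (_ ⊗ₜ _)]
    simp only [Algebra.TensorProduct.tmul_mul_tmul, Units.inv_mul, mul_one,
      ← Algebra.TensorProduct.one_def, one_mul, ← map_mul, map_one]
  have h2 : (((1 : H) ⊗ₜ[k] (F : H ⊗[k] H)) * dr (F : H ⊗[k] H)) *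
      (dr ((F⁻¹ : (H ⊗[k] H)ˣ) : H ⊗[k] H) *
        ((1 : H) ⊗ₜ[k] ((F⁻¹ : (H ⊗[k] H)ˣ) : H ⊗[k] H))) = 1 := by
    rw [mul_assoc, ← mul_assoc (dr _) (dr _), ← map_mul]
    simp only [Algebra.TensorProduct.tmul_mul_tmul, Units.mul_inv, mul_one,
      ← Algebra.TensorProduct.one_def, one_mul, map_one]
  rw [hc] at h1
  have h3 := left_inv_eq_right_inv h1 h2
  rw [map_twistedComul_left, map_twistedComul_right, twistedComul_apply]
  simp only [map_mul]
  calc _ = (a ((F : H ⊗[k] H) ⊗ₜ[k] (1 : H)) * a (dl (F : H ⊗[k] H))) *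
        a (dl (Bialgebra.comulAlgHom k H x)) *
        (a (dl ((F⁻¹ : (H ⊗[k] H)ˣ) : H ⊗[k] H)) *
          a (((F⁻¹ : (H ⊗[k] H)ˣ) : H ⊗[k] H) ⊗ₜ[k] (1 : H))) := by
        simp only [mul_assoc]; rfl
    _ = _ := by rw [hc, hco, h3]; simp only [mul_assoc]; rfl

theorem IsTwist.rTensor_counit {F : (H ⊗[k] H)ˣ} (hF : IsTwist F) (x : H) :
    Algebra.TensorProduct.map (Bialgebra.counitAlgHom k H) (AlgHom.id k H) (twistedComul F x) =
      (1 : k) ⊗ₜ[k] x := by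
  apply (Algebra.TensorProduct.lid k H).injective
  have h0 : Algebra.TensorProduct.map (Bialgebra.counitAlgHom k H) (AlgHom.id k H)
      (Bialgebra.comulAlgHom k H x) = (1 : k) ⊗ₜ[k] x :=
    Coalgebra.rTensor_counit_comul (R := k) x
  have hi : Algebra.TensorProduct.lid k H (Algebra.TensorProduct.map
      (Bialgebra.counitAlgHom k H) (AlgHom.id k H) ((F⁻¹ : (H ⊗[k] H)ˣ) : H ⊗[k] H)) = 1 := by
    have := hF.counit_left
    rw [← one_mul (Algebra.TensorProduct.lid k H _), ← this, ← map_mul, ← map_mul,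
      Units.mul_inv, map_one, map_one, this]
  rw [twistedComul_apply, map_mul, map_mul, map_mul, map_mul, hi, hF.counit_left, h0, one_mul,
    mul_one]

theorem IsTwist.lTensor_counit {F : (H ⊗[k] H)ˣ} (hF : IsTwist F) (x : H) :
    Algebra.TensorProduct.map (AlgHom.id k H) (Bialgebra.counitAlgHom k H) (twistedComul F x) =
      x ⊗ₜ[k] (1 : k) := by
  apply (Algebra.TensorProduct.rid k k H).injective
  have h0 : Algebra.TensorProduct.map (AlgHom.id k H) (Bialgebra.counitAlgHom k H)
      (Bialgebra.comulAlgHom k H x) = x ⊗ₜ[k] (1 : k) :=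
    Coalgebra.lTensor_counit_comul (R := k) x
  have hi : Algebra.TensorProduct.rid k k H (Algebra.TensorProduct.map
      (AlgHom.id k H) (Bialgebra.counitAlgHom k H) ((F⁻¹ : (H ⊗[k] H)ˣ) : H ⊗[k] H)) = 1 := by
    have := hF.counit_right
    rw [← one_mul (Algebra.TensorProduct.rid k k H _), ← this, ← map_mul, ← map_mul,
      Units.mul_inv, map_one, map_one, this]
  rw [twistedComul_apply, map_mul, map_mul, map_mul, map_mul, hi, hF.counit_right, h0, one_mul,
    mul_one]

/-- The bialgebra structure `(m, u, Δ_F, ε)` on the algebra `H`. -/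
abbrev twistedBialgebra {F : (H ⊗[k] H)ˣ} (hF : IsTwist F) : Bialgebra k H :=
  Bialgebra.ofAlgHom (twistedComul F) (Bialgebra.counitAlgHom k H)
    (AlgHom.ext hF.coassoc) (AlgHom.ext hF.rTensor_counit) (AlgHom.ext hF.lTensor_counit)

/-- The bialgebra `H_F`: the algebra `H` with comultiplication `Δ_F` and counit `ε`. -/
def Twisted {F : (H ⊗[k] H)ˣ} (_ : IsTwist F) : Type _ := H

instance {F : (H ⊗[k] H)ˣ} (hF : IsTwist F) : Ring (Twisted hF) := inferInstanceAs (Ring H)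

instance {F : (H ⊗[k] H)ˣ} (hF : IsTwist F) : Bialgebra k (Twisted hF) :=
  let B : Bialgebra k H := twistedBialgebra hF
  B

/-- The identity map of `H`, as an isomorphism of algebras `H ≃ H_F`. -/
def Twisted.of {F : (H ⊗[k] H)ˣ} (hF : IsTwist F) : H ≃ₐ[k] Twisted hF :=
  (AlgEquiv.refl : H ≃ₐ[k] H)

/-- `R_F = F^op R F⁻¹`, as an element of `H_F ⊗ H_F`. -/
def twistedR {F : (H ⊗[k] H)ˣ} (hF : IsTwist F) (R : (H ⊗[k] H)ˣ) :
    (Twisted hF ⊗[k] Twisted hF)ˣ :=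
  Units.map (Algebra.TensorProduct.map (Twisted.of hF : H →ₐ[k] Twisted hF)
      (Twisted.of hF : H →ₐ[k] Twisted hF) : H ⊗[k] H →* Twisted hF ⊗[k] Twisted hF)
    (opUnit F * R * F⁻¹)

end Bialg

/-! ### Morphisms of triangular bialgebras and twisted morphisms -/

section Morphisms

variable {H : Type*} [Ring H] [Bialgebra k H]
variable {H' : Type*} [Ring H'] [Bialgebra k H']
variable {H'' : Type*} [Ring H''] [Bialgebra k H'']

/-- The bialgebra map `f : H → H'` is a morphism `(H, R) → (H', R')` in `Tr`:
`(f ⊗ f)(R) = R'`. -/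
def IsTrHom (R : (H ⊗[k] H)ˣ) (R' : (H' ⊗[k] H')ˣ) (f : H →ₐc[k] H') : Prop :=
  Algebra.TensorProduct.map (f : H →ₐ[k] H') (f : H →ₐ[k] H') (R : H ⊗[k] H) = (R' : H' ⊗[k] H')

/-- A pair `(f, F)` of an algebra map `f : H → H'` and an invertible element `F` of `H' ⊗ H'`:
the data underlying a twisted morphism. -/
@[ext]
structure Pair (k : Type u) [Field k] (H : Type*) [Ring H] [Bialgebra k H]
    (H' : Type*) [Ring H'] [Bialgebra k H'] where
  /-- The algebra map. -/
  hom : H →ₐ[k] H'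
  /-- The invertible element. -/
  elt : (H' ⊗[k] H')ˣ

/-- `(Id, 1 ⊗ 1)`. -/
def Pair.id (k : Type u) [Field k] (H : Type*) [Ring H] [Bialgebra k H] : Pair k H H :=
  ⟨AlgHom.id k H, 1⟩

/-- `(f', F') ∘ (f, F) = (f' f, (f' ⊗ f')(F) F')`. -/
def Pair.comp (q : Pair k H' H'') (p : Pair k H H') : Pair k H H'' :=
  ⟨q.hom.comp p.hom,
    Units.map (Algebra.TensorProduct.map q.hom q.hom : H' ⊗[k] H' →* H'' ⊗[k] H'') p.elt * q.elt⟩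

/-- `(f, F)` is a 1-cell `H → H'` in `Tw`: `F` is a twist on `H'` and `f : H → H'_F` is a
bialgebra map. -/
def IsTwCell (p : Pair k H H') : Prop :=
  ∃ (hF : IsTwist p.elt) (f : H →ₐc[k] Twisted hF),
    (f : H →ₐ[k] Twisted hF) = (Twisted.of hF : H' →ₐ[k] Twisted hF).comp p.hom

/-- `(f, F)` is a 1-cell `(H, R) → (H', R')` in `TwTr`: `F` is a twist on `H'` and
`f : (H, R) → (H'_F, R'_F)` is a morphism in `Tr`. -/
def IsTwTrCell (R : (H ⊗[k] H)ˣ) (R' : (H' ⊗[k] H')ˣ) (p : Pair k H H') : Prop :=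
  ∃ (hF : IsTwist p.elt) (f : H →ₐc[k] Twisted hF),
    (f : H →ₐ[k] Twisted hF) = (Twisted.of hF : H' →ₐ[k] Twisted hF).comp p.hom ∧
    IsTrHom R (twistedR hF R') f

/-- `(f, F)` is an invertible 1-cell `(H, R) → (H', R')` in `TwTr`. -/
def IsInvertibleTwTrCell (R : (H ⊗[k] H)ˣ) (R' : (H' ⊗[k] H')ˣ) (p : Pair k H H') : Prop :=
  IsTwTrCell R R' p ∧
    ∃ q : Pair k H' H, IsTwTrCell R' R q ∧ q.comp p = Pair.id k H ∧ p.comp q = Pair.id k H'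

end Morphisms

/-! ### Products -/

section Product

variable {H : Type*} [Ring H] [Bialgebra k H]
variable {H₁ : Type*} [Ring H₁] [Bialgebra k H₁]
variable {H₂ : Type*} [Ring H₂] [Bialgebra k H₂]

/-- `(Id ⊗ τ ⊗ Id)(T₁ ⊗ T₂)`, an element of `(H₁ ⊗ H₂) ⊗ (H₁ ⊗ H₂)`. For triangular structures
`T₁ = R₁`, `T₂ = R₂` it is the triangular structure of `(H₁, R₁) ⊗ (H₂, R₂)`. -/
def middle (T₁ : (H₁ ⊗[k] H₁)ˣ) (T₂ : (H₂ ⊗[k] H₂)ˣ) :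
    ((H₁ ⊗[k] H₂) ⊗[k] (H₁ ⊗[k] H₂))ˣ :=
  Units.map (Algebra.TensorProduct.tensorTensorTensorComm k k k k H₁ H₁ H₂ H₂ :
      (H₁ ⊗[k] H₁) ⊗[k] (H₂ ⊗[k] H₂) →* (H₁ ⊗[k] H₂) ⊗[k] (H₁ ⊗[k] H₂))
    (Units.map (Algebra.TensorProduct.includeLeft :
        H₁ ⊗[k] H₁ →ₐ[k] (H₁ ⊗[k] H₁) ⊗[k] (H₂ ⊗[k] H₂)).toMonoidHom T₁ *
      Units.map (Algebra.TensorProduct.includeRight :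
        H₂ ⊗[k] H₂ →ₐ[k] (H₁ ⊗[k] H₁) ⊗[k] (H₂ ⊗[k] H₂)).toMonoidHom T₂)

theorem middle_val (T₁ : (H₁ ⊗[k] H₁)ˣ) (T₂ : (H₂ ⊗[k] H₂)ˣ) :
    (middle T₁ T₂ : (H₁ ⊗[k] H₂) ⊗[k] (H₁ ⊗[k] H₂)) =
      Algebra.TensorProduct.tensorTensorTensorComm k k k k H₁ H₁ H₂ H₂
        ((T₁ : H₁ ⊗[k] H₁) ⊗ₜ[k] (T₂ : H₂ ⊗[k] H₂)) := by
  simp [middle, -map_mul]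

/-- The map `w ↦ 1 ⊗ w ⊗ 1`, from `H₂ ⊗ H₁` to `(H₁ ⊗ H₂) ⊗ (H₁ ⊗ H₂)`. -/
def inner : H₂ ⊗[k] H₁ →ₐ[k] (H₁ ⊗[k] H₂) ⊗[k] (H₁ ⊗[k] H₂) :=
  Algebra.TensorProduct.map Algebra.TensorProduct.includeRight Algebra.TensorProduct.includeLeft

/-- The diagonal `⟨(f₁, F₁), (f₂, F₂)⟩`, the pair of `(f₁ ⊗ f₂)Δ` and
`(1 ⊗ (f₂ ⊗ f₁)(R⁻¹) ⊗ 1) (Id ⊗ τ ⊗ Id)(F₁ ⊗ F₂)`. -/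
def diagonal (R : (H ⊗[k] H)ˣ) (p₁ : Pair k H H₁) (p₂ : Pair k H H₂) : Pair k H (H₁ ⊗[k] H₂) :=
  ⟨(Algebra.TensorProduct.map p₁.hom p₂.hom).comp (Bialgebra.comulAlgHom k H),
    Units.map (inner.comp (Algebra.TensorProduct.map p₂.hom p₁.hom) :
        H ⊗[k] H →ₐ[k] (H₁ ⊗[k] H₂) ⊗[k] (H₁ ⊗[k] H₂)).toMonoidHom R⁻¹ *
      middle p₁.elt p₂.elt⟩

/-! ### The four conditions, for given factors -/

/-- There is an invertible 1-cell `(f, F) : (H, R) → (H₁, R₁) ⊗ (H₂, R₂)` in `TwTr`. -/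
def HasInvertibleCell (R : (H ⊗[k] H)ˣ) (R₁ : (H₁ ⊗[k] H₁)ˣ) (R₂ : (H₂ ⊗[k] H₂)ˣ) : Prop :=
  ∃ p : Pair k H (H₁ ⊗[k] H₂), IsInvertibleTwTrCell R (middle R₁ R₂) p

/-- There are twists `Fᵢ` of `Hᵢ` and surjective morphisms
`fᵢ : (H, R) → ((Hᵢ)_{Fᵢ}, (Rᵢ)_{Fᵢ})` in `Tr` such that the diagonal `⟨(f₁, F₁), (f₂, F₂)⟩` is an
invertible 1-cell `(H, R) → (H₁, R₁) ⊗ (H₂, R₂)` in `TwTr`. -/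
def HasInvertibleDiagonal (R : (H ⊗[k] H)ˣ) (R₁ : (H₁ ⊗[k] H₁)ˣ) (R₂ : (H₂ ⊗[k] H₂)ˣ) : Prop :=
  ∃ (p₁ : Pair k H H₁) (p₂ : Pair k H H₂),
    IsTwTrCell R R₁ p₁ ∧ Function.Surjective p₁.hom ∧
    IsTwTrCell R R₂ p₂ ∧ Function.Surjective p₂.hom ∧
    IsInvertibleTwTrCell R (middle R₁ R₂) (diagonal R p₁ p₂)

/-- `(H, R)` is a twisted tensor product of `(H₁, R₁)` and `(H₂, R₂)`: there are a twist `F` on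
`H₁ ⊗ H₂` and an isomorphism `(H, R) → ((H₁ ⊗ H₂)_F, R̃_F)` in `Tr`. -/
def IsTwistedTensorProduct (R : (H ⊗[k] H)ˣ) (R₁ : (H₁ ⊗[k] H₁)ˣ) (R₂ : (H₂ ⊗[k] H₂)ˣ) : Prop :=
  ∃ (F : ((H₁ ⊗[k] H₂) ⊗[k] (H₁ ⊗[k] H₂))ˣ) (hF : IsTwist F) (e : H ≃ₐc[k] Twisted hF),
    IsTrHom R (twistedR hF (middle R₁ R₂)) (e : H →ₐc[k] Twisted hF)

variable (H₁ H₂) in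
/-- There are twists `Fᵢ` of `Hᵢ` and surjective bialgebra maps `fᵢ : H → (Hᵢ)_{Fᵢ}` such that
`(f₁ ⊗ f₂)Δ : H → (H₁ ⊗ H₂)_F` is an isomorphism of bialgebras, where
`F = (1 ⊗ (f₂ ⊗ f₁)(R⁻¹) ⊗ 1) (Id ⊗ τ ⊗ Id)(F₁ ⊗ F₂)`; that `F` is a twist, so that
`(H₁ ⊗ H₂)_F` is defined, is part of the condition. -/
def HasDiagonalIso (R : (H ⊗[k] H)ˣ) : Prop :=
  ∃ (p₁ : Pair k H H₁) (p₂ : Pair k H H₂),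
    IsTwCell p₁ ∧ Function.Surjective p₁.hom ∧
    IsTwCell p₂ ∧ Function.Surjective p₂.hom ∧
    ∃ (hF : IsTwist (diagonal R p₁ p₂).elt) (e : H ≃ₐc[k] Twisted hF),
      ((e : H →ₐc[k] Twisted hF) : H →ₐ[k] Twisted hF) =
        (Twisted.of hF : H₁ ⊗[k] H₂ →ₐ[k] Twisted hF).comp (diagonal R p₁ p₂).hom

end Product

end TwTr

end

/-! The identities in the definitions live in tensor powers of a bialgebra and are tested here by
evaluation. For algebra maps a, b : H → A with commuting images, an invertible T = ∑ x ⊗ y has a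
value T(a, b) = ∑ a(x) b(y), a unit of A, and the convolution a * b is again an algebra map. The
cocycle equation becomes F(a, b) F(a * b, c) = F(b, c) F(a, b * c), and the hexagons become R(a, b *
c) = R(a, c) R(a, b) and R(a * b, c) = R(a, c) R(b, c). The inclusions of the tensor factors are the
universal case, so no information is lost, and most proofs become computations in a group of units.

Three facts carry the equivalence of 1, 2 and 3. A 1-cell (f, F) with f bijective is invertible,
with inverse (f⁻¹, (f⁻¹ ⊗ f⁻¹)(F⁻¹)) (`IsTwTrCell.isInvertible`); hence 1 and 3 say the same. The
diagonal of two 1-cells is always a 1-cell, being their tensor product composed with the 1-cell (Δ,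
1 ⊗ R⁻¹ ⊗ 1) : (H, R) → (H, R) ⊗ (H, R) (`IsTwTrCell.diagonal`). Finally, let (f, F) be invertible
and let f₁, f₂ be f followed by Id ⊗ ε and ε ⊗ Id. Then (f₁ ⊗ f₂)Δ is f conjugated by the unit ((Id
⊗ ε) ⊗ (ε ⊗ Id))(F), so it is still bijective (`diagonal_proj_bijective`) and the diagonal of the
components is invertible.

Condition 4 mentions no triangular structures on the factors, but they are forced: Rᵢ must be
(Fᵢ^op)⁻¹ (fᵢ ⊗ fᵢ)(R) Fᵢ, and surjectivity of fᵢ makes this element triangular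
(`IsTwCellData.isTriangular_push`). All implications keep the factors H₁, H₂, and those among 1, 2,
3 also keep R₁, R₂, which gives the refined statements. -/

noncomputable section

namespace TwTr

variable {k : Type u} [Field k]

/-! ### Evaluation of tensors along pairwise commuting algebra maps -/

section Legs

variable {H : Type*} [Ring H] [Algebra k H]
variable {K : Type*} [Ring K] [Algebra k K]
variable {L : Type*} [Ring L] [Algebra k L]
variable {A : Type*} [Ring A] [Algebra k A]
variable {B : Type*} [Ring B] [Algebra k B]

/-- The images of `a` and `b` commute elementwise. -/
abbrev CommHom (a : H →ₐ[k] A) (b : K →ₐ[k] A) : Prop := ∀ x y, Commute (a x) (b y)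

theorem CommHom.symm {a : H →ₐ[k] A} {b : K →ₐ[k] A} (h : CommHom a b) : CommHom b a :=
  fun x y => (h y x).symm

theorem CommHom.map (g : A →ₐ[k] B) {a : H →ₐ[k] A} {b : K →ₐ[k] A} (h : CommHom a b) :
    CommHom (g.comp a) (g.comp b) :=
  fun x y => (h x y).map g

theorem CommHom.comp_left {H' : Type*} [Ring H'] [Algebra k H'] {a : H →ₐ[k] A} {b : K →ₐ[k] A}
    (h : CommHom a b) (f : H' →ₐ[k] H) : CommHom (a.comp f) b :=
  fun x y => h (f x) y

theorem CommHom.comp_right {K' : Type*} [Ring K'] [Algebra k K'] {a : H →ₐ[k] A} {b : K →ₐ[k] A}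
    (h : CommHom a b) (f : K' →ₐ[k] K) : CommHom a (b.comp f) :=
  fun x y => h x (f y)

/-- The element `∑ a(x) b(y)` of `A`, for an invertible `T = ∑ x ⊗ y`. -/
def ev (a : H →ₐ[k] A) (b : K →ₐ[k] A) (h : CommHom a b) (T : (H ⊗[k] K)ˣ) : Aˣ :=
  Units.map (Algebra.TensorProduct.lift a b h : H ⊗[k] K →* A) T

theorem ev_val (a : H →ₐ[k] A) (b : K →ₐ[k] A) (h : CommHom a b) (T : (H ⊗[k] K)ˣ) :
    (ev a b h T : A) = Algebra.TensorProduct.lift a b h (T : H ⊗[k] K) := rfl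

theorem commute_lift {a : H →ₐ[k] A} {b : K →ₐ[k] A} (h : CommHom a b) {z : A}
    (ha : ∀ x, Commute (a x) z) (hb : ∀ y, Commute (b y) z) (T : H ⊗[k] K) :
    Commute (Algebra.TensorProduct.lift a b h T) z := by
  induction T with
  | zero => simp
  | tmul x y => simpa using (ha x).mul_left (hb y)
  | add x y hx hy => simpa using hx.add_left hy

theorem commute_ev {a : H →ₐ[k] A} {b : K →ₐ[k] A} (h : CommHom a b) {z : Aˣ}
    (ha : ∀ x, Commute (a x) (z : A)) (hb : ∀ y, Commute (b y) (z : A)) (T : (H ⊗[k] K)ˣ) :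
    Commute (ev a b h T) z :=
  Units.ext (commute_lift h ha hb _)

theorem commute_hom_ev {a : H →ₐ[k] A} {b : K →ₐ[k] A}
    {c : L →ₐ[k] A} (h : CommHom a b) (hac : CommHom a c) (hbc : CommHom b c) (T : (H ⊗[k] K)ˣ)
    (z : L) : Commute (c z) (ev a b h T : A) :=
  (commute_lift h (fun x => hac x z) (fun y => hbc y z) _).symm

theorem lift_comp_map {H' : Type*} [Ring H'] [Algebra k H'] {K' : Type*} [Ring K'] [Algebra k K']
    (a : H →ₐ[k] A) (b : K →ₐ[k] A) (h : CommHom a b)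
    (f : H' →ₐ[k] H) (g : K' →ₐ[k] K) :
    (Algebra.TensorProduct.lift a b h).comp (Algebra.TensorProduct.map f g) =
      Algebra.TensorProduct.lift (a.comp f) (b.comp g) ((h.comp_left f).comp_right g) := by
  ext <;> simp

theorem comp_lift (g : A →ₐ[k] B) (a : H →ₐ[k] A) (b : K →ₐ[k] A) (h : CommHom a b) :
    g.comp (Algebra.TensorProduct.lift a b h) =
      Algebra.TensorProduct.lift (g.comp a) (g.comp b) (h.map g) := by
  ext <;> simp

theorem ev_mul (a : H →ₐ[k] A) (b : K →ₐ[k] A) (h : CommHom a b) (S T : (H ⊗[k] K)ˣ) :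
    ev a b h (S * T) = ev a b h S * ev a b h T := map_mul _ _ _

theorem ev_one (a : H →ₐ[k] A) (b : K →ₐ[k] A) (h : CommHom a b) :
    ev a b h 1 = 1 := map_one _

theorem ev_inv (a : H →ₐ[k] A) (b : K →ₐ[k] A) (h : CommHom a b) (T : (H ⊗[k] K)ˣ) :
    ev a b h T⁻¹ = (ev a b h T)⁻¹ := map_inv _ _

theorem ev_map {H' : Type*} [Ring H'] [Algebra k H'] {K' : Type*} [Ring K'] [Algebra k K']
    (a : H →ₐ[k] A) (b : K →ₐ[k] A) (h : CommHom a b)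
    (f : H' →ₐ[k] H) (g : K' →ₐ[k] K) (T : (H' ⊗[k] K')ˣ) :
    ev a b h (Units.map (Algebra.TensorProduct.map f g : H' ⊗[k] K' →* H ⊗[k] K) T) =
      ev (a.comp f) (b.comp g) ((h.comp_left f).comp_right g) T :=
  Units.ext (DFunLike.congr_fun (lift_comp_map a b h f g) (T : H' ⊗[k] K'))

/-- Both sides send x ⊗ y ⊗ z to a(x) b(y) c(z). The associator is absorbed here, so that later
identities between values carry no bracketing. -/
theorem lift_assoc (a : H →ₐ[k] A) (b : K →ₐ[k] A)
    (c : L →ₐ[k] A) (hab : CommHom a b) (hac : CommHom a c) (hbc : CommHom b c)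
    (T : (H ⊗[k] K) ⊗[k] L) :
    Algebra.TensorProduct.lift a (Algebra.TensorProduct.lift b c hbc)
        (fun x _ => (commute_lift hbc (fun y => (hab x y).symm) (fun y => (hac x y).symm) _).symm)
        (Algebra.TensorProduct.assoc k k k H K L T) =
      Algebra.TensorProduct.lift (Algebra.TensorProduct.lift a b hab) c
        (fun _ z => commute_lift hab (fun y => hac y z) (fun y => hbc y z) _) T := by
  have : (Algebra.TensorProduct.lift a (Algebra.TensorProduct.lift b c hbc)
        (fun x _ => (commute_lift hbc (fun y => (hab x y).symm)
          (fun y => (hac x y).symm) _).symm)).comp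
      (Algebra.TensorProduct.assoc k k k H K L : (H ⊗[k] K) ⊗[k] L →ₐ[k] H ⊗[k] (K ⊗[k] L)) =
      Algebra.TensorProduct.lift (Algebra.TensorProduct.lift a b hab) c
        (fun _ z => commute_lift hab (fun y => hac y z) (fun y => hbc y z) _) := by
    ext <;> simp [Algebra.TensorProduct.one_def]
  exact DFunLike.congr_fun this T

/-- Conjugation in the first leg. -/
theorem lift_mul_left_of_conj {α α' : H →ₐ[k] A} {c : K →ₐ[k] A} (h : CommHom α c)
    (h' : CommHom α' c) (u : Aˣ) (hu : ∀ x, α x * u = u * α' x)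
    (hc : ∀ y, Commute (c y) (u : A)) (T : H ⊗[k] K) :
    Algebra.TensorProduct.lift α c h T * u = u * Algebra.TensorProduct.lift α' c h' T := by
  induction T with
  | zero => simp
  | tmul x y =>
    simp only [Algebra.TensorProduct.lift_tmul]
    rw [mul_assoc, hc y, ← mul_assoc, hu, mul_assoc]
  | add x y hx hy => simp only [map_add, add_mul, mul_add, hx, hy]

theorem ev_mul_left_of_conj {α α' : H →ₐ[k] A} {c : K →ₐ[k] A} (h : CommHom α c)
    (h' : CommHom α' c) (u : Aˣ) (hu : ∀ x, α x * u = u * α' x)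
    (hc : ∀ y, Commute (c y) (u : A)) (T : (H ⊗[k] K)ˣ) :
    ev α c h T * u = u * ev α' c h' T :=
  Units.ext (lift_mul_left_of_conj h h' u hu hc _)

/-- Conjugation in the second leg. -/
theorem lift_mul_right_of_conj {α α' : K →ₐ[k] A} {c : H →ₐ[k] A} (h : CommHom c α)
    (h' : CommHom c α') (u : Aˣ) (hu : ∀ x, α x * u = u * α' x)
    (hc : ∀ y, Commute (c y) (u : A)) (T : H ⊗[k] K) :
    Algebra.TensorProduct.lift c α h T * u = u * Algebra.TensorProduct.lift c α' h' T := by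
  induction T with
  | zero => simp
  | tmul x y =>
    simp only [Algebra.TensorProduct.lift_tmul]
    rw [mul_assoc, hu, ← mul_assoc, hc x, mul_assoc]
  | add x y hx hy => simp only [map_add, add_mul, mul_add, hx, hy]

theorem ev_mul_right_of_conj {α α' : K →ₐ[k] A} {c : H →ₐ[k] A} (h : CommHom c α)
    (h' : CommHom c α') (u : Aˣ) (hu : ∀ x, α x * u = u * α' x)
    (hc : ∀ y, Commute (c y) (u : A)) (T : (H ⊗[k] K)ˣ) :
    ev c α h T * u = u * ev c α' h' T :=
  Units.ext (lift_mul_right_of_conj h h' u hu hc _)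

end Legs

/-! ### Convolution of commuting algebra maps -/

section Conv

variable {H : Type*} [Ring H] [Bialgebra k H]
variable {K : Type*} [Ring K] [Algebra k K]
variable {A : Type*} [Ring A] [Algebra k A]
variable {B : Type*} [Ring B] [Algebra k B]

/-- The convolution product of `a` and `b`, an algebra map since their images commute. -/
def conv (a b : H →ₐ[k] A) (h : CommHom a b) : H →ₐ[k] A :=
  (Algebra.TensorProduct.lift a b h).comp (Bialgebra.comulAlgHom k H)

variable (k H A) in
/-- The neutral element of the convolution product. -/
def convUnit : H →ₐ[k] A := (Algebra.ofId k A).comp (Bialgebra.counitAlgHom k H)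

theorem conv_apply (a b : H →ₐ[k] A) (h : CommHom a b) (x : H) :
    conv a b h x = Algebra.TensorProduct.lift a b h (Bialgebra.comulAlgHom k H x) := rfl

theorem commHom_convUnit_left (b : K →ₐ[k] A) : CommHom (convUnit k H A) b :=
  fun _ _ => Algebra.commutes _ _

theorem commHom_convUnit_right (b : K →ₐ[k] A) : CommHom b (convUnit k H A) :=
  (commHom_convUnit_left b).symm

theorem CommHom.conv_left {a b : H →ₐ[k] A} {c : K →ₐ[k] A} (h : CommHom a b)
    (hac : CommHom a c) (hbc : CommHom b c) : CommHom (conv a b h) c :=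
  fun _ y => commute_lift h (fun z => hac z y) (fun z => hbc z y) _

theorem CommHom.conv_right {a b : H →ₐ[k] A} {c : K →ₐ[k] A} (h : CommHom a b)
    (hca : CommHom c a) (hcb : CommHom c b) : CommHom c (conv a b h) :=
  (h.conv_left hca.symm hcb.symm).symm

theorem ev_opUnit (a b : H →ₐ[k] A) (h : CommHom a b) (T : (H ⊗[k] H)ˣ) :
    ev a b h (opUnit T) = ev b a h.symm T := by
  have : (Algebra.TensorProduct.lift a b h).comp
      (Algebra.TensorProduct.comm k H H : H ⊗[k] H →ₐ[k] H ⊗[k] H) =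
      Algebra.TensorProduct.lift b a h.symm := by
    ext <;> simp
  exact Units.ext (DFunLike.congr_fun this (T : H ⊗[k] H))

/-- Coassociativity of Δ, evaluated at (a, b, c). -/
theorem conv_assoc (a b c : H →ₐ[k] A) (hab : CommHom a b) (hac : CommHom a c)
    (hbc : CommHom b c) :
    conv (conv a b hab) c (hab.conv_left hac hbc) =
      conv a (conv b c hbc) (hbc.conv_right hab hac) := by
  ext x
  have h1 := lift_assoc a b c hab hac hbc (Algebra.TensorProduct.map
    (Bialgebra.comulAlgHom k H) (AlgHom.id k H) (Bialgebra.comulAlgHom k H x))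
  have hco : Algebra.TensorProduct.assoc k k k H H H (Algebra.TensorProduct.map
      (Bialgebra.comulAlgHom k H) (AlgHom.id k H) (Bialgebra.comulAlgHom k H x)) =
      Algebra.TensorProduct.map (AlgHom.id k H) (Bialgebra.comulAlgHom k H)
        (Bialgebra.comulAlgHom k H x) :=
    Coalgebra.coassoc_apply (R := k) x
  rw [hco] at h1
  have hl := DFunLike.congr_fun (lift_comp_map (Algebra.TensorProduct.lift a b hab) c
    (fun _ z => commute_lift hab (fun y => hac y z) (fun y => hbc y z) _)
    (Bialgebra.comulAlgHom k H) (AlgHom.id k H)) (Bialgebra.comulAlgHom k H x)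
  have hr := DFunLike.congr_fun (lift_comp_map a (Algebra.TensorProduct.lift b c hbc)
    (fun x _ => (commute_lift hbc (fun y => (hab x y).symm) (fun y => (hac x y).symm) _).symm)
    (AlgHom.id k H) (Bialgebra.comulAlgHom k H)) (Bialgebra.comulAlgHom k H x)
  exact hl.symm.trans (h1.symm.trans hr)

theorem conv_convUnit_left (b : H →ₐ[k] A) :
    conv (convUnit k H A) b (commHom_convUnit_left b) = b := by
  ext x
  have h0 : Algebra.TensorProduct.map (Bialgebra.counitAlgHom k H) (AlgHom.id k H)
      (Bialgebra.comulAlgHom k H x) = (1 : k) ⊗ₜ[k] x :=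
    Coalgebra.rTensor_counit_comul (R := k) x
  have hc : CommHom (Algebra.ofId k A) b := fun _ _ => Algebra.commutes _ _
  have h1 := DFunLike.congr_fun (lift_comp_map (Algebra.ofId k A) b hc
    (Bialgebra.counitAlgHom k H) (AlgHom.id k H))
    (Bialgebra.comulAlgHom k H x)
  rw [AlgHom.comp_apply, h0] at h1
  exact h1.symm.trans (by simp)

theorem conv_convUnit_right (b : H →ₐ[k] A) :
    conv b (convUnit k H A) (commHom_convUnit_right b) = b := by
  ext x
  have h0 : Algebra.TensorProduct.map (AlgHom.id k H) (Bialgebra.counitAlgHom k H)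
      (Bialgebra.comulAlgHom k H x) = x ⊗ₜ[k] (1 : k) :=
    Coalgebra.lTensor_counit_comul (R := k) x
  have hc : CommHom b (Algebra.ofId k A) := fun _ _ => (Algebra.commutes _ _).symm
  have h1 := DFunLike.congr_fun (lift_comp_map b (Algebra.ofId k A) hc
    (AlgHom.id k H) (Bialgebra.counitAlgHom k H))
    (Bialgebra.comulAlgHom k H x)
  rw [AlgHom.comp_apply, h0] at h1
  exact h1.symm.trans (by simp)

/-! ### Twists and triangular structures along commuting algebra maps -/

theorem ev_conv_left (a b : H →ₐ[k] A) (c : K →ₐ[k] A) (hab : CommHom a b) (hac : CommHom a c)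
    (hbc : CommHom b c) (T : (H ⊗[k] K)ˣ) :
    (ev (conv a b hab) c (hab.conv_left hac hbc) T : A) =
      Algebra.TensorProduct.lift (Algebra.TensorProduct.lift a b hab) c
        (fun _ z => commute_lift hab (fun y => hac y z) (fun y => hbc y z) _)
        (Algebra.TensorProduct.map (Bialgebra.comulAlgHom k H) (AlgHom.id k K) (T : H ⊗[k] K)) :=
  (DFunLike.congr_fun (lift_comp_map (Algebra.TensorProduct.lift a b hab) c
    (fun _ z => commute_lift hab (fun y => hac y z) (fun y => hbc y z) _)
    (Bialgebra.comulAlgHom k H) (AlgHom.id k K)) (T : H ⊗[k] K)).symm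

theorem ev_conv_right (a : K →ₐ[k] A) (b c : H →ₐ[k] A) (hab : CommHom a b) (hac : CommHom a c)
    (hbc : CommHom b c) (T : (K ⊗[k] H)ˣ) :
    (ev a (conv b c hbc) (hbc.conv_right hab hac) T : A) =
      Algebra.TensorProduct.lift a (Algebra.TensorProduct.lift b c hbc)
        (fun x _ => (commute_lift hbc (fun y => (hab x y).symm)
          (fun y => (hac x y).symm) _).symm)
        (Algebra.TensorProduct.map (AlgHom.id k K) (Bialgebra.comulAlgHom k H) (T : K ⊗[k] H)) :=
  (DFunLike.congr_fun (lift_comp_map a (Algebra.TensorProduct.lift b c hbc)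
    (fun x _ => (commute_lift hbc (fun y => (hab x y).symm) (fun y => (hac x y).symm) _).symm)
    (AlgHom.id k K) (Bialgebra.comulAlgHom k H)) (T : K ⊗[k] H)).symm

/-- The evaluation at (a, b, c) is an algebra map on the triple tensor product; it turns a
comultiplication applied in one leg into a convolution. -/
theorem IsTwist.ev_cocycle {F : (H ⊗[k] H)ˣ} (hF : IsTwist F) (a b c : H →ₐ[k] A)
    (hab : CommHom a b) (hac : CommHom a c) (hbc : CommHom b c) :
    ev a b hab F * ev (conv a b hab) c (hab.conv_left hac hbc) F =
      ev b c hbc F * ev a (conv b c hbc) (hbc.conv_right hab hac) F := by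
  refine Units.ext ?_
  have h := congrArg (Algebra.TensorProduct.lift a (Algebra.TensorProduct.lift b c hbc)
    (fun x _ => (commute_lift hbc (fun y => (hab x y).symm) (fun y => (hac x y).symm) _).symm))
    hF.cocycle
  rw [lift_assoc a b c hab hac hbc, map_mul, map_mul] at h
  simpa only [Units.val_mul, ev_val, ← ev_conv_left a b c hab hac hbc,
    ← ev_conv_right a b c hab hac hbc, Algebra.TensorProduct.lift_tmul, map_one, mul_one,
    one_mul] using h

theorem IsTwist.ev_counit_left {F : (H ⊗[k] H)ˣ} (hF : IsTwist F) (b : H →ₐ[k] A) :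
    ev (convUnit k H A) b (commHom_convUnit_left b) F = 1 := by
  have : (b.comp (Algebra.TensorProduct.lid k H : k ⊗[k] H →ₐ[k] H)).comp
      (Algebra.TensorProduct.map (Bialgebra.counitAlgHom k H) (AlgHom.id k H)) =
      Algebra.TensorProduct.lift (convUnit k H A) b (commHom_convUnit_left b) := by
    ext x <;> simp [convUnit, Algebra.ofId_apply, Algebra.algebraMap_eq_smul_one]
  refine Units.ext ((DFunLike.congr_fun this (F : H ⊗[k] H)).symm.trans ?_)
  exact (congrArg b hF.counit_left).trans (map_one b)

theorem IsTwist.ev_counit_right {F : (H ⊗[k] H)ˣ} (hF : IsTwist F) (b : H →ₐ[k] A) :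
    ev b (convUnit k H A) (commHom_convUnit_right b) F = 1 := by
  have : (b.comp (Algebra.TensorProduct.rid k k H : H ⊗[k] k →ₐ[k] H)).comp
      (Algebra.TensorProduct.map (AlgHom.id k H) (Bialgebra.counitAlgHom k H)) =
      Algebra.TensorProduct.lift b (convUnit k H A) (commHom_convUnit_right b) := by
    ext x <;> simp [convUnit, Algebra.ofId_apply, Algebra.algebraMap_eq_smul_one]
  refine Units.ext ((DFunLike.congr_fun this (F : H ⊗[k] H)).symm.trans ?_)
  exact (congrArg b hF.counit_right).trans (map_one b)

/-- This is Δ^op R = R Δ evaluated at (a, b): the value R(a, b) intertwines a * b with b * a. -/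
theorem IsTriangular.conv_swap_mul {R : (H ⊗[k] H)ˣ} (hR : IsTriangular R) (a b : H →ₐ[k] A)
    (h : CommHom a b) (x : H) :
    conv b a h.symm x * ev a b h R = ev a b h R * conv a b h x := by
  have h1 := congrArg (Algebra.TensorProduct.lift a b h) (hR.comul_op x)
  have h2 : (Algebra.TensorProduct.lift a b h).comp
      (Algebra.TensorProduct.comm k H H : H ⊗[k] H →ₐ[k] H ⊗[k] H) =
      Algebra.TensorProduct.lift b a h.symm := by
    ext <;> simp
  have h3 := DFunLike.congr_fun h2 (Bialgebra.comulAlgHom k H x)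
  rw [conv_apply, ← h3]
  refine (congrArg (· * (ev a b h R : A)) h1).trans ?_
  rw [ev_val, ← map_mul, mul_assoc, mul_assoc, Units.inv_mul, mul_one, map_mul, conv_apply]

theorem IsTriangular.ev_conv_right {R : (H ⊗[k] H)ˣ} (hR : IsTriangular R) (a b c : H →ₐ[k] A)
    (hab : CommHom a b) (hac : CommHom a c) (hbc : CommHom b c) :
    ev a (conv b c hbc) (hbc.conv_right hab hac) R = ev a c hac R * ev a b hab R := by
  refine Units.ext ?_
  rw [TwTr.ev_conv_right a b c hab hac hbc, hR.hexagon_right, map_mul]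
  simp only [← AlgHom.comp_apply, lift_comp_map]
  simp only [Algebra.TensorProduct.lift_comp_includeLeft, AlgHom.comp_id, Units.val_mul, ev_val,
    Algebra.TensorProduct.lift_comp_includeRight']

theorem IsTriangular.ev_conv_left {R : (H ⊗[k] H)ˣ} (hR : IsTriangular R) (a b c : H →ₐ[k] A)
    (hab : CommHom a b) (hac : CommHom a c) (hbc : CommHom b c) :
    ev (conv a b hab) c (hab.conv_left hac hbc) R = ev a c hac R * ev b c hbc R := by
  refine Units.ext ?_
  rw [TwTr.ev_conv_left a b c hab hac hbc, hR.hexagon_left, map_mul]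
  simp only [← AlgHom.comp_apply, lift_comp_map]
  simp only [Algebra.TensorProduct.lift_comp_includeLeft, AlgHom.comp_id, Units.val_mul, ev_val,
    Algebra.TensorProduct.lift_comp_includeRight']

theorem IsTriangular.ev_swap {R : (H ⊗[k] H)ˣ} (hR : IsTriangular R) (a b : H →ₐ[k] A)
    (h : CommHom a b) : ev b a h.symm R = (ev a b h R)⁻¹ := by
  rw [← ev_inv, hR.inv_eq_op, ev_opUnit]

/-- Normalisation is not an axiom for R. The hexagon at (ε, ε, b), with ε * ε = ε, makes the value
an idempotent of a group. -/
theorem IsTriangular.ev_counit_left {R : (H ⊗[k] H)ˣ} (hR : IsTriangular R) (b : H →ₐ[k] A) :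
    ev (convUnit k H A) b (commHom_convUnit_left b) R = 1 := by
  have h := hR.ev_conv_left (convUnit k H A) (convUnit k H A) b (commHom_convUnit_left _)
    (commHom_convUnit_left _) (commHom_convUnit_left _)
  simpa only [conv_convUnit_left, left_eq_mul] using h

theorem IsTriangular.ev_counit_right {R : (H ⊗[k] H)ˣ} (hR : IsTriangular R) (b : H →ₐ[k] A) :
    ev b (convUnit k H A) (commHom_convUnit_right b) R = 1 := by
  rw [hR.ev_swap _ _ (commHom_convUnit_left b), hR.ev_counit_left, inv_one]

/-! ### Recognising twists and triangular structures -/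

variable (k H) in
/-- The inclusion of the first factor of `H ⊗ (H ⊗ H)`. -/
def leg₁ : H →ₐ[k] H ⊗[k] (H ⊗[k] H) := Algebra.TensorProduct.includeLeft

variable (k H) in
/-- The inclusion of the second factor. -/
def leg₂ : H →ₐ[k] H ⊗[k] (H ⊗[k] H) :=
  Algebra.TensorProduct.includeRight.comp Algebra.TensorProduct.includeLeft

variable (k H) in
/-- The inclusion of the third factor. -/
def leg₃ : H →ₐ[k] H ⊗[k] (H ⊗[k] H) :=
  Algebra.TensorProduct.includeRight.comp Algebra.TensorProduct.includeRight

theorem commHom_leg₁₂ : CommHom (leg₁ k H) (leg₂ k H) := fun x y => by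
  simp [leg₁, leg₂, Commute, SemiconjBy]

theorem commHom_leg₁₃ : CommHom (leg₁ k H) (leg₃ k H) := fun x y => by
  simp [leg₁, leg₃, Commute, SemiconjBy]

theorem commHom_leg₂₃ : CommHom (leg₂ k H) (leg₃ k H) := fun x y => by
  simp [leg₂, leg₃, Commute, SemiconjBy]

theorem lift_legs :
    Algebra.TensorProduct.lift (leg₁ k H)
      (Algebra.TensorProduct.lift (leg₂ k H) (leg₃ k H) (commHom_leg₂₃ (k := k)))
      (fun x _ => (commute_lift (commHom_leg₂₃ (k := k))
        (fun y => (commHom_leg₁₂ (k := k) x y).symm)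
          (fun y => (commHom_leg₁₃ (k := k) x y).symm) _).symm) =
      AlgHom.id k (H ⊗[k] (H ⊗[k] H)) := by
  ext <;> simp [leg₁, leg₂, leg₃]

theorem lift_legs_symm (T : (H ⊗[k] H) ⊗[k] H) :
    Algebra.TensorProduct.lift (Algebra.TensorProduct.lift (leg₁ k H) (leg₂ k H) commHom_leg₁₂)
      (leg₃ k H) (fun _ z => commute_lift commHom_leg₁₂ (fun y => commHom_leg₁₃ y z)
          (fun y => commHom_leg₂₃ y z) _) T = Algebra.TensorProduct.assoc k k k H H H T := by
  rw [← lift_assoc _ _ _ commHom_leg₁₂ commHom_leg₁₃ commHom_leg₂₃]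
  exact DFunLike.congr_fun lift_legs _

/-- Evaluation at the three legs is the identity of the triple tensor product, so the cocycle
equation there is the original one. -/
theorem IsTwist.of_legs {F : (H ⊗[k] H)ˣ}
    (h : ev (leg₁ k H) (leg₂ k H) commHom_leg₁₂ F *
      ev (conv (leg₁ k H) (leg₂ k H) commHom_leg₁₂) (leg₃ k H)
        (commHom_leg₁₂.conv_left commHom_leg₁₃ commHom_leg₂₃) F =
      ev (leg₂ k H) (leg₃ k H) commHom_leg₂₃ F *
      ev (leg₁ k H) (conv (leg₂ k H) (leg₃ k H) commHom_leg₂₃)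
        (commHom_leg₂₃.conv_right commHom_leg₁₂ commHom_leg₁₃) F)
    (hl : ev (convUnit k H H) (AlgHom.id k H) (commHom_convUnit_left _) F = 1)
    (hr : ev (AlgHom.id k H) (convUnit k H H) (commHom_convUnit_right _) F = 1) :
    IsTwist F where
  cocycle := by
    have h' := congrArg (Units.val) h
    simp only [Units.val_mul, ev_conv_left _ _ _ commHom_leg₁₂ commHom_leg₁₃ commHom_leg₂₃,
      ev_conv_right _ _ _ commHom_leg₁₂ commHom_leg₁₃ commHom_leg₂₃, lift_legs, lift_legs_symm,
      AlgHom.id_apply] at h'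
    rw [map_mul, ← lift_legs_symm, Algebra.TensorProduct.lift_tmul, map_one, mul_one]
    refine h'.trans ?_
    congr 1
    have := DFunLike.congr_fun (lift_legs (k := k) (H := H)) (1 ⊗ₜ (F : H ⊗[k] H))
    rw [Algebra.TensorProduct.lift_tmul, map_one, one_mul] at this
    exact this
  counit_left := by
    have : (Algebra.TensorProduct.lid k H : k ⊗[k] H →ₐ[k] H).comp
        (Algebra.TensorProduct.map (Bialgebra.counitAlgHom k H) (AlgHom.id k H)) =
        Algebra.TensorProduct.lift (convUnit k H H) (AlgHom.id k H) (commHom_convUnit_left _) := by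
      ext x <;> simp [convUnit, Algebra.ofId_apply, Algebra.algebraMap_eq_smul_one]
    exact (DFunLike.congr_fun this (F : H ⊗[k] H)).trans (congrArg Units.val hl)
  counit_right := by
    have : (Algebra.TensorProduct.rid k k H : H ⊗[k] k →ₐ[k] H).comp
        (Algebra.TensorProduct.map (AlgHom.id k H) (Bialgebra.counitAlgHom k H)) =
        Algebra.TensorProduct.lift (AlgHom.id k H) (convUnit k H H) (commHom_convUnit_right _) := by
      ext x <;> simp [convUnit, Algebra.ofId_apply, Algebra.algebraMap_eq_smul_one]
    exact (DFunLike.congr_fun this (F : H ⊗[k] H)).trans (congrArg Units.val hr)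

end Conv

/-! ### The universal commuting pair and the test for triangularity -/

section Recognition

variable {H : Type*} [Ring H] [Bialgebra k H]
variable {K : Type*} [Ring K] [Algebra k K]
variable {A : Type*} [Ring A] [Algebra k A]

variable (k H K) in
/-- `x ↦ x ⊗ 1`. -/
abbrev inl : H →ₐ[k] H ⊗[k] K := Algebra.TensorProduct.includeLeft

variable (k H K) in
/-- `y ↦ 1 ⊗ y`. -/
abbrev inr : K →ₐ[k] H ⊗[k] K := Algebra.TensorProduct.includeRight

theorem commHom_inl_inr : CommHom (inl k H K) (inr k H K) := fun x y => by
  simp [Commute, SemiconjBy]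

theorem lift_inl_inr :
    Algebra.TensorProduct.lift (inl k H K) (inr k H K) commHom_inl_inr =
      AlgHom.id k (H ⊗[k] K) := by
  ext <;> simp

theorem ev_inl_inr (T : (H ⊗[k] K)ˣ) : ev (inl k H K) (inr k H K) commHom_inl_inr T = T :=
  Units.ext (DFunLike.congr_fun lift_inl_inr (T : H ⊗[k] K))

theorem conv_inl_inr :
    conv (inl k H H) (inr k H H) commHom_inl_inr = Bialgebra.comulAlgHom k H := by
  rw [conv, lift_inl_inr, AlgHom.id_comp]

theorem ev_inr_inl (T : (H ⊗[k] H)ˣ) :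
    ev (inr k H H) (inl k H H) commHom_inl_inr.symm T = opUnit T := by
  rw [← ev_opUnit _ _ commHom_inl_inr, ev_inl_inr]

theorem conv_inr_inl (x : H) :
    conv (inr k H H) (inl k H H) commHom_inl_inr.symm x =
      Algebra.TensorProduct.comm k H H (Bialgebra.comulAlgHom k H x) := by
  have : Algebra.TensorProduct.lift (inr k H H) (inl k H H) commHom_inl_inr.symm =
      (Algebra.TensorProduct.comm k H H : H ⊗[k] H →ₐ[k] H ⊗[k] H) := by
    ext <;> simp
  rw [conv_apply, this]; rfl

theorem lift_leg₁_leg₂ : Algebra.TensorProduct.lift (leg₁ k H) (leg₂ k H) commHom_leg₁₂ =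
    Algebra.TensorProduct.map (AlgHom.id k H) Algebra.TensorProduct.includeLeft := by
  ext <;> simp [leg₁, leg₂]

theorem lift_leg₁_leg₃ : Algebra.TensorProduct.lift (leg₁ k H) (leg₃ k H) commHom_leg₁₃ =
    Algebra.TensorProduct.map (AlgHom.id k H) Algebra.TensorProduct.includeRight := by
  ext <;> simp [leg₁, leg₃]

theorem lift_leg₁_leg₃_assoc :
    Algebra.TensorProduct.lift (leg₁ k H) (leg₃ k H) commHom_leg₁₃ =
      (Algebra.TensorProduct.assoc k k k H H H :
        (H ⊗[k] H) ⊗[k] H →ₐ[k] H ⊗[k] (H ⊗[k] H)).comp (Algebra.TensorProduct.map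
          Algebra.TensorProduct.includeLeft (AlgHom.id k H)) := by
  ext <;> simp [leg₁, leg₃, Algebra.TensorProduct.one_def]

theorem lift_leg₂_leg₃_assoc :
    Algebra.TensorProduct.lift (leg₂ k H) (leg₃ k H) commHom_leg₂₃ =
      (Algebra.TensorProduct.assoc k k k H H H :
        (H ⊗[k] H) ⊗[k] H →ₐ[k] H ⊗[k] (H ⊗[k] H)).comp (Algebra.TensorProduct.map
          Algebra.TensorProduct.includeRight (AlgHom.id k H)) := by
  ext <;> simp [leg₂, leg₃]

theorem IsTriangular.of_legs {R : (H ⊗[k] H)ˣ}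
    (hc : ∀ x, conv (inr k H H) (inl k H H) commHom_inl_inr.symm x *
        ev (inl k H H) (inr k H H) commHom_inl_inr R =
      ev (inl k H H) (inr k H H) commHom_inl_inr R *
        conv (inl k H H) (inr k H H) commHom_inl_inr x)
    (hr : ev (leg₁ k H) (conv (leg₂ k H) (leg₃ k H) commHom_leg₂₃)
        (commHom_leg₂₃.conv_right commHom_leg₁₂ commHom_leg₁₃) R =
      ev (leg₁ k H) (leg₃ k H) commHom_leg₁₃ R * ev (leg₁ k H) (leg₂ k H) commHom_leg₁₂ R)
    (hl : ev (conv (leg₁ k H) (leg₂ k H) commHom_leg₁₂) (leg₃ k H)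
        (commHom_leg₁₂.conv_left commHom_leg₁₃ commHom_leg₂₃) R =
      ev (leg₁ k H) (leg₃ k H) commHom_leg₁₃ R * ev (leg₂ k H) (leg₃ k H) commHom_leg₂₃ R)
    (ho : opUnit R = R⁻¹) : IsTriangular R where
  comul_op x := by
    have h := hc x
    rw [conv_inr_inl, conv_inl_inr, ev_inl_inr] at h
    rw [← h, mul_assoc, Units.mul_inv, mul_one]
  hexagon_right := by
    have h' := congrArg Units.val hr
    rw [TwTr.ev_conv_right (leg₁ k H) (leg₂ k H) (leg₃ k H)
      commHom_leg₁₂ commHom_leg₁₃ commHom_leg₂₃, lift_legs] at h'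
    rw [Units.val_mul, ev_val, ev_val, lift_leg₁_leg₃, lift_leg₁_leg₂] at h'
    exact h'
  hexagon_left := by
    have h' := congrArg Units.val hl
    rw [TwTr.ev_conv_left (leg₁ k H) (leg₂ k H) (leg₃ k H)
      commHom_leg₁₂ commHom_leg₁₃ commHom_leg₂₃, lift_legs_symm] at h'
    apply (Algebra.TensorProduct.assoc k k k H H H).injective
    rw [Units.val_mul, ev_val, ev_val, lift_leg₁_leg₃_assoc, lift_leg₂_leg₃_assoc] at h'
    rw [map_mul]
    exact h'
  inv_eq_op := ho.symm

end Recognition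

/-! ### Twisted morphisms along commuting algebra maps -/

section Cells

variable {H : Type*} [Ring H] [Bialgebra k H]
variable {H' : Type*} [Ring H'] [Bialgebra k H']
variable {A : Type*} [Ring A] [Algebra k A]

theorem conv_comp_self (p : Pair k H H') (x : H) :
    conv ((inl k H' H').comp p.hom) ((inr k H' H').comp p.hom)
        ((commHom_inl_inr.comp_left p.hom).comp_right p.hom) x =
      Algebra.TensorProduct.map p.hom p.hom (Bialgebra.comulAlgHom k H x) := by
  rw [conv_apply, ← lift_comp_map _ _ commHom_inl_inr, AlgHom.comp_apply, lift_inl_inr,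
    AlgHom.id_apply]

/-- `f : H → H'_F` is a map of bialgebras. -/
structure IsTwCellData (p : Pair k H H') : Prop where
  isTwist : IsTwist p.elt
  comul : ∀ x : H, Algebra.TensorProduct.map p.hom p.hom (Bialgebra.comulAlgHom k H x) =
    twistedComul p.elt (p.hom x)
  counit : (Bialgebra.counitAlgHom k H').comp p.hom = Bialgebra.counitAlgHom k H

/-- The bialgebra map `H → H'_F`. -/
def IsTwCellData.bialgHom {p : Pair k H H'} (h : IsTwCellData p) : H →ₐc[k] Twisted h.isTwist :=
  BialgHom.ofAlgHom ((Twisted.of h.isTwist : H' →ₐ[k] Twisted h.isTwist).comp p.hom)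
    h.counit (AlgHom.ext h.comul)

theorem isTwCellData_of_bialgHom {p : Pair k H H'} (hF : IsTwist p.elt) (f : H →ₐc[k] Twisted hF)
    (hf : (f : H →ₐ[k] Twisted hF) = (Twisted.of hF : H' →ₐ[k] Twisted hF).comp p.hom) :
    IsTwCellData p where
  isTwist := hF
  comul x := by
    have h := DFunLike.congr_fun (BialgHom.map_comp_comulAlgHom f) x
    rw [hf] at h
    exact h
  counit := by
    have h := BialgHom.counitAlgHom_comp f
    rw [hf] at h
    exact h

theorem isTwCell_iff {p : Pair k H H'} : IsTwCell p ↔ IsTwCellData p :=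
  ⟨fun ⟨hF, f, hf⟩ => isTwCellData_of_bialgHom hF f hf, fun h => ⟨h.isTwist, h.bialgHom, rfl⟩⟩

theorem isTrHom_iff {R : (H ⊗[k] H)ˣ} {R' : (H' ⊗[k] H')ˣ} {p : Pair k H H'} (hF : IsTwist p.elt)
    (f : H →ₐc[k] Twisted hF)
    (hf : (f : H →ₐ[k] Twisted hF) = (Twisted.of hF : H' →ₐ[k] Twisted hF).comp p.hom) :
    IsTrHom R (twistedR hF R') f ↔
      Units.map (Algebra.TensorProduct.map p.hom p.hom : H ⊗[k] H →* H' ⊗[k] H') R =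
        opUnit p.elt * R' * p.elt⁻¹ := by
  -- `Twisted hF` is `H'` by definition and `Twisted.of hF` is the identity, so transporting the
  -- twisted R-matrix changes nothing.
  have hid : Algebra.TensorProduct.map (AlgHom.id k H') (AlgHom.id k H') =
      AlgHom.id k (H' ⊗[k] H') := Algebra.TensorProduct.map_id
  rw [IsTrHom, hf, Units.ext_iff]
  have h2 : ((twistedR hF R' : (Twisted hF ⊗[k] Twisted hF)ˣ) : Twisted hF ⊗[k] Twisted hF) =
      ((opUnit p.elt * R' * p.elt⁻¹ : (H' ⊗[k] H')ˣ) : H' ⊗[k] H') :=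
    DFunLike.congr_fun hid _
  rw [h2]
  rfl

theorem isTwTrCell_iff {R : (H ⊗[k] H)ˣ} {R' : (H' ⊗[k] H')ˣ} {p : Pair k H H'} :
    IsTwTrCell R R' p ↔ IsTwCellData p ∧
      Units.map (Algebra.TensorProduct.map p.hom p.hom : H ⊗[k] H →* H' ⊗[k] H') R =
        opUnit p.elt * R' * p.elt⁻¹ :=
  ⟨fun ⟨hF, f, hf, h⟩ => ⟨isTwCellData_of_bialgHom hF f hf, (isTrHom_iff hF f hf).1 h⟩,
    fun ⟨h, h'⟩ => ⟨h.isTwist, h.bialgHom, rfl, (isTrHom_iff h.isTwist h.bialgHom rfl).2 h'⟩⟩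

/-- Evaluating (f ⊗ f)Δ = F Δ(f) F⁻¹ at (a, b) shows that a 1-cell respects convolution only up to
conjugation by F(a, b). -/
theorem IsTwCellData.conv_mul {p : Pair k H H'} (hp : IsTwCellData p) (a b : H' →ₐ[k] A)
    (h : CommHom a b) (x : H) :
    conv (a.comp p.hom) (b.comp p.hom) ((h.comp_left p.hom).comp_right p.hom) x *
        ev a b h p.elt = ev a b h p.elt * conv a b h (p.hom x) := by
  have h1 := congrArg (Algebra.TensorProduct.lift a b h) (hp.comul x)
  rw [← AlgHom.comp_apply, lift_comp_map, twistedComul_apply, map_mul, map_mul] at h1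
  have h2 : Algebra.TensorProduct.lift a b h (p.elt⁻¹ : (H' ⊗[k] H')ˣ) *
      Algebra.TensorProduct.lift a b h p.elt = 1 := by
    rw [← map_mul, Units.inv_mul, map_one]
  rw [conv_apply, h1, ev_val, mul_assoc, h2, mul_one, conv_apply]

theorem IsTwCellData.convUnit_comp {p : Pair k H H'} (hp : IsTwCellData p) :
    (convUnit k H' A).comp p.hom = convUnit k H A := by
  rw [convUnit, AlgHom.comp_assoc, hp.counit, convUnit]

theorem IsTwCellData.of_legs {p : Pair k H H'} (hF : IsTwist p.elt)
    (hc : ∀ x, conv ((inl k H' H').comp p.hom) ((inr k H' H').comp p.hom)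
        ((commHom_inl_inr.comp_left p.hom).comp_right p.hom) x *
        ev (inl k H' H') (inr k H' H') commHom_inl_inr p.elt =
      ev (inl k H' H') (inr k H' H') commHom_inl_inr p.elt *
        conv (inl k H' H') (inr k H' H') commHom_inl_inr (p.hom x))
    (he : (convUnit k H' k).comp p.hom = convUnit k H k) : IsTwCellData p where
  isTwist := hF
  comul x := by
    have h := hc x
    rw [conv_comp_self, ev_inl_inr, conv_inl_inr] at h
    rw [twistedComul_apply, ← h, mul_assoc, Units.mul_inv, mul_one]
  counit := AlgHom.ext fun x => DFunLike.congr_fun he x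

theorem ev_comp_comp (p : Pair k H H') (a b : H' →ₐ[k] A) (h : CommHom a b) (T : (H ⊗[k] H)ˣ) :
    ev (a.comp p.hom) (b.comp p.hom) ((h.comp_left p.hom).comp_right p.hom) T =
      ev a b h (Units.map (Algebra.TensorProduct.map p.hom p.hom : H ⊗[k] H →* H' ⊗[k] H') T) :=
  (ev_map a b h p.hom p.hom T).symm

theorem IsTwTrCell.data {R : (H ⊗[k] H)ˣ} {R' : (H' ⊗[k] H')ˣ} {p : Pair k H H'}
    (hp : IsTwTrCell R R' p) : IsTwCellData p := (isTwTrCell_iff.1 hp).1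

theorem IsTwTrCell.ev_comp {R : (H ⊗[k] H)ˣ} {R' : (H' ⊗[k] H')ˣ} {p : Pair k H H'}
    (hp : IsTwTrCell R R' p) (a b : H' →ₐ[k] A) (h : CommHom a b) :
    ev (a.comp p.hom) (b.comp p.hom) ((h.comp_left p.hom).comp_right p.hom) R =
      ev b a h.symm p.elt * ev a b h R' * (ev a b h p.elt)⁻¹ := by
  rw [ev_comp_comp, (isTwTrCell_iff.1 hp).2, ev_mul, ev_mul, ev_inv, ev_opUnit]

theorem IsTwTrCell.of_legs {R : (H ⊗[k] H)ˣ} {R' : (H' ⊗[k] H')ˣ} {p : Pair k H H'}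
    (hp : IsTwCellData p)
    (hR : ev ((inl k H' H').comp p.hom) ((inr k H' H').comp p.hom)
        ((commHom_inl_inr.comp_left p.hom).comp_right p.hom) R =
      ev (inr k H' H') (inl k H' H') commHom_inl_inr.symm p.elt *
        ev (inl k H' H') (inr k H' H') commHom_inl_inr R' *
        (ev (inl k H' H') (inr k H' H') commHom_inl_inr p.elt)⁻¹) : IsTwTrCell R R' p := by
  refine isTwTrCell_iff.2 ⟨hp, ?_⟩
  rwa [ev_comp_comp p _ _ commHom_inl_inr, ev_inl_inr, ev_inl_inr, ev_inl_inr, ev_inr_inl] at hR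

end Cells

/-! ### Composition and inversion of twisted morphisms -/

section Composition

variable {H : Type*} [Ring H] [Bialgebra k H]
variable {H' : Type*} [Ring H'] [Bialgebra k H']
variable {H'' : Type*} [Ring H''] [Bialgebra k H'']
variable {A : Type*} [Ring A] [Algebra k A]

theorem IsTwCellData.ev_conv_left {p : Pair k H H'} (hp : IsTwCellData p) (a b c : H' →ₐ[k] A)
    (hab : CommHom a b) (hac : CommHom a c) (hbc : CommHom b c) (T : (H ⊗[k] H)ˣ) :
    ev (conv (a.comp p.hom) (b.comp p.hom) ((hab.comp_left p.hom).comp_right p.hom))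
        (c.comp p.hom) (CommHom.conv_left _ ((hac.comp_left p.hom).comp_right p.hom)
          ((hbc.comp_left p.hom).comp_right p.hom)) T * ev a b hab p.elt =
      ev a b hab p.elt * ev ((conv a b hab).comp p.hom) (c.comp p.hom)
        (((hab.conv_left hac hbc).comp_left p.hom).comp_right p.hom) T :=
  ev_mul_left_of_conj _ _ _ (hp.conv_mul a b hab)
    (fun y => commute_hom_ev hab hac hbc p.elt (p.hom y)) T

theorem IsTwCellData.ev_conv_right {p : Pair k H H'} (hp : IsTwCellData p) (a b c : H' →ₐ[k] A)
    (hab : CommHom a b) (hac : CommHom a c) (hbc : CommHom b c) (T : (H ⊗[k] H)ˣ) :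
    ev (a.comp p.hom)
        (conv (b.comp p.hom) (c.comp p.hom) ((hbc.comp_left p.hom).comp_right p.hom))
        (CommHom.conv_right _ ((hab.comp_left p.hom).comp_right p.hom)
          ((hac.comp_left p.hom).comp_right p.hom)) T * ev b c hbc p.elt =
      ev b c hbc p.elt * ev (a.comp p.hom) ((conv b c hbc).comp p.hom)
        (((hbc.conv_right hab hac).comp_left p.hom).comp_right p.hom) T :=
  ev_mul_right_of_conj _ _ _ (hp.conv_mul b c hbc)
    (fun y => commute_hom_ev hbc hab.symm hac.symm p.elt (p.hom y)) T

theorem ev_comp_elt (q : Pair k H' H'') (p : Pair k H H') (a b : H'' →ₐ[k] A) (h : CommHom a b) :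
    ev a b h (q.comp p).elt =
      ev (a.comp q.hom) (b.comp q.hom) ((h.comp_left q.hom).comp_right q.hom) p.elt *
        ev a b h q.elt := by
  rw [ev_comp_comp, ← ev_mul]; rfl

theorem IsTwCellData.ev_counit_left {p : Pair k H H'} (hp : IsTwCellData p) (b : H' →ₐ[k] A)
    (T : (H ⊗[k] H)ˣ) :
    ev ((convUnit k H' A).comp p.hom) (b.comp p.hom)
        (((commHom_convUnit_left b).comp_left p.hom).comp_right p.hom) T =
      ev (convUnit k H A) (b.comp p.hom) (commHom_convUnit_left _) T := by
  simp only [hp.convUnit_comp]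

theorem IsTwCellData.ev_counit_right {p : Pair k H H'} (hp : IsTwCellData p) (b : H' →ₐ[k] A)
    (T : (H ⊗[k] H)ˣ) :
    ev (b.comp p.hom) ((convUnit k H' A).comp p.hom)
        (((commHom_convUnit_right b).comp_left p.hom).comp_right p.hom) T =
      ev (b.comp p.hom) (convUnit k H A) (commHom_convUnit_right _) T := by
  simp only [hp.convUnit_comp]

/-- The twist of a composite has values F(a f', b f') F'(a, b). Moving F'(a, b) past a value of F
replaces (a f') * (b f') by (a * b) f'; the cocycle equations of F at (a f', b f', c f') and of F'
at (a, b, c) then combine. -/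
theorem IsTwCellData.comp_cocycle {q : Pair k H' H''} {p : Pair k H H'} (hq : IsTwCellData q)
    (hp : IsTwCellData p) (a b c : H'' →ₐ[k] A) (hab : CommHom a b) (hac : CommHom a c)
    (hbc : CommHom b c) :
    ev a b hab (q.comp p).elt * ev (conv a b hab) c (hab.conv_left hac hbc) (q.comp p).elt =
      ev b c hbc (q.comp p).elt * ev a (conv b c hbc) (hbc.conv_right hab hac) (q.comp p).elt := by
  rw [ev_comp_elt, ev_comp_elt, ev_comp_elt, ev_comp_elt]
  have h1 := hq.ev_conv_left a b c hab hac hbc p.elt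
  have h2 := hq.ev_conv_right a b c hab hac hbc p.elt
  have h3 := hq.isTwist.ev_cocycle a b c hab hac hbc
  have h4 := hp.isTwist.ev_cocycle (a.comp q.hom) (b.comp q.hom) (c.comp q.hom)
    ((hab.comp_left q.hom).comp_right q.hom) ((hac.comp_left q.hom).comp_right q.hom)
    ((hbc.comp_left q.hom).comp_right q.hom)
  rw [mul_assoc, ← mul_assoc (ev a b _ q.elt), ← h1, mul_assoc (ev (conv _ _ _) _ _ _), h3,
    ← mul_assoc, h4, mul_assoc, ← mul_assoc (ev _ (conv _ _ _) _ _), h2]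
  simp only [mul_assoc]

theorem IsTwCellData.comp {q : Pair k H' H''} {p : Pair k H H'} (hq : IsTwCellData q)
    (hp : IsTwCellData p) : IsTwCellData (q.comp p) := by
  refine .of_legs (.of_legs (hq.comp_cocycle hp _ _ _ commHom_leg₁₂ commHom_leg₁₃
    commHom_leg₂₃) ?_ ?_) ?_ ?_
  · rw [ev_comp_elt, hq.isTwist.ev_counit_left, hq.ev_counit_left, hp.isTwist.ev_counit_left,
      mul_one]
  · rw [ev_comp_elt, hq.isTwist.ev_counit_right, hq.ev_counit_right, hp.isTwist.ev_counit_right,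
      mul_one]
  · intro x
    rw [ev_comp_elt]
    have h1 := hp.conv_mul ((inl k H'' H'').comp q.hom) ((inr k H'' H'').comp q.hom)
      ((commHom_inl_inr.comp_left q.hom).comp_right q.hom) x
    have h2 := hq.conv_mul (inl k H'' H'') (inr k H'' H'') commHom_inl_inr (p.hom x)
    rw [Units.val_mul, ← mul_assoc]
    refine (congrArg (· * _) h1).trans ?_
    rw [mul_assoc, h2, ← mul_assoc]
    rfl
  · exact ((congrArg (AlgHom.comp · p.hom) hq.convUnit_comp)).trans hp.convUnit_comp

theorem IsTwTrCell.comp {R : (H ⊗[k] H)ˣ} {R' : (H' ⊗[k] H')ˣ} {R'' : (H'' ⊗[k] H'')ˣ}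
    {q : Pair k H' H''} {p : Pair k H H'} (hq : IsTwTrCell R' R'' q) (hp : IsTwTrCell R R' p) :
    IsTwTrCell R R'' (q.comp p) := by
  refine .of_legs (hq.data.comp hp.data) ?_
  rw [ev_comp_elt, ev_comp_elt]
  have h1 := hp.ev_comp ((inl k H'' H'').comp q.hom) ((inr k H'' H'').comp q.hom)
    ((commHom_inl_inr.comp_left q.hom).comp_right q.hom)
  have h2 := hq.ev_comp (inl k H'' H'') (inr k H'' H'') commHom_inl_inr
  refine h1.trans ?_
  rw [h2, mul_inv_rev]
  simp only [mul_assoc]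

/-- The inverse of a twisted morphism whose underlying algebra map is bijective. -/
def Pair.inv (p : Pair k H H') (e : H ≃ₐ[k] H') : Pair k H' H :=
  ⟨e.symm, Units.map (Algebra.TensorProduct.map (e.symm : H' →ₐ[k] H) (e.symm : H' →ₐ[k] H) :
    H' ⊗[k] H' →* H ⊗[k] H) p.elt⁻¹⟩

theorem ev_inv_elt (p : Pair k H H') (e : H ≃ₐ[k] H') (a b : H →ₐ[k] A) (h : CommHom a b) :
    ev a b h (p.inv e).elt = (ev (a.comp (e.symm : H' →ₐ[k] H)) (b.comp (e.symm : H' →ₐ[k] H))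
      ((h.comp_left _).comp_right _) p.elt)⁻¹ := by
  rw [← ev_inv]
  exact ev_map a b h _ _ _

theorem comp_symm_comp {p : Pair k H H'} {e : H ≃ₐ[k] H'} (he : (e : H →ₐ[k] H') = p.hom)
    (a : H →ₐ[k] A) : (a.comp (e.symm : H' →ₐ[k] H)).comp p.hom = a := by
  ext x; simp [← he]

theorem IsTwCellData.conv_mul_inv {p : Pair k H H'} (hp : IsTwCellData p) {e : H ≃ₐ[k] H'}
    (he : (e : H →ₐ[k] H') = p.hom) (a b : H →ₐ[k] A) (h : CommHom a b) (y : H') :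
    conv a b h (e.symm y) * ev (a.comp (e.symm : H' →ₐ[k] H)) (b.comp (e.symm : H' →ₐ[k] H))
        ((h.comp_left _).comp_right _) p.elt =
      ev (a.comp (e.symm : H' →ₐ[k] H)) (b.comp (e.symm : H' →ₐ[k] H))
        ((h.comp_left _).comp_right _) p.elt *
        conv (a.comp (e.symm : H' →ₐ[k] H)) (b.comp (e.symm : H' →ₐ[k] H))
        ((h.comp_left _).comp_right _) y := by
  have h1 := hp.conv_mul (a.comp (e.symm : H' →ₐ[k] H)) (b.comp (e.symm : H' →ₐ[k] H))
    ((h.comp_left _).comp_right _) (e.symm y)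
  have h2 : p.hom (e.symm y) = y := by rw [← he]; exact e.apply_symm_apply y
  simpa only [comp_symm_comp he, h2] using h1

/-- With s = f⁻¹, the twist of the inverse has values F(a s, b s)⁻¹. Conjugation by F(a s, b s)
turns (a * b) s into (a s) * (b s), so the claim is the inverted cocycle equation of F at (a s, b s,
c s). -/
theorem IsTwCellData.inv_cocycle {p : Pair k H H'} (hp : IsTwCellData p) {e : H ≃ₐ[k] H'}
    (he : (e : H →ₐ[k] H') = p.hom) (a b c : H →ₐ[k] A) (hab : CommHom a b) (hac : CommHom a c)
    (hbc : CommHom b c) :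
    ev a b hab (p.inv e).elt * ev (conv a b hab) c (hab.conv_left hac hbc) (p.inv e).elt =
      ev b c hbc (p.inv e).elt * ev a (conv b c hbc) (hbc.conv_right hab hac) (p.inv e).elt := by
  set s : H' →ₐ[k] H := (e.symm : H' →ₐ[k] H)
  have hab' := (hab.comp_left s).comp_right s
  have hac' := (hac.comp_left s).comp_right s
  have hbc' := (hbc.comp_left s).comp_right s
  have h1 := ev_mul_left_of_conj (((hab.conv_left hac hbc).comp_left s).comp_right s)
    (hab'.conv_left hac' hbc') (ev (a.comp s) (b.comp s) hab' p.elt)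
    (hp.conv_mul_inv he a b hab) (commute_hom_ev hab' hac' hbc' _) p.elt
  have h2 := ev_mul_right_of_conj (((hbc.conv_right hab hac).comp_left s).comp_right s)
    (hbc'.conv_right hab' hac') (ev (b.comp s) (c.comp s) hbc' p.elt)
    (hp.conv_mul_inv he b c hbc) (commute_hom_ev hbc' hab'.symm hac'.symm _) p.elt
  rw [ev_inv_elt, ev_inv_elt, ev_inv_elt, ev_inv_elt, ← mul_inv_rev, ← mul_inv_rev, h1, h2,
    hp.isTwist.ev_cocycle _ _ _ hab' hac' hbc']

theorem IsTwCellData.inv {p : Pair k H H'} (hp : IsTwCellData p) {e : H ≃ₐ[k] H'}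
    (he : (e : H →ₐ[k] H') = p.hom) : IsTwCellData (p.inv e) := by
  have hu : (convUnit k H H).comp (e.symm : H' →ₐ[k] H) = convUnit k H' H := by
    rw [← hp.convUnit_comp, ← he]; ext x; simp
  have hu' : (convUnit k H k).comp (e.symm : H' →ₐ[k] H) = convUnit k H' k := by
    rw [← hp.convUnit_comp, ← he]; ext x; simp
  refine .of_legs (.of_legs (hp.inv_cocycle he _ _ _ commHom_leg₁₂ commHom_leg₁₃
    commHom_leg₂₃) ?_ ?_) (fun y => ?_) hu'
  · rw [ev_inv_elt]
    simp only [hu, hp.isTwist.ev_counit_left, inv_one]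
  · rw [ev_inv_elt]
    simp only [hu, hp.isTwist.ev_counit_right, inv_one]
  · have h := hp.conv_mul_inv he (inl k H H) (inr k H H) commHom_inl_inr y
    rw [ev_inv_elt, Units.mul_inv_eq_iff_eq_mul, mul_assoc, Units.eq_inv_mul_iff_mul_eq]
    exact h.symm

/-- Bijectivity of the algebra map is the only obstruction: the inverse algebra map with the
transported inverse twist is again a 1-cell, and the elements in both composites cancel. -/
theorem IsTwTrCell.isInvertible {R : (H ⊗[k] H)ˣ} {R' : (H' ⊗[k] H')ˣ} {p : Pair k H H'}
    (hp : IsTwTrCell R R' p) (hb : Function.Bijective p.hom) : IsInvertibleTwTrCell R R' p := by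
  let e : H ≃ₐ[k] H' := AlgEquiv.ofBijective p.hom hb
  have he : (e : H →ₐ[k] H') = p.hom := rfl
  have hs : (e.symm : H' →ₐ[k] H).comp p.hom = AlgHom.id k H :=
    AlgHom.ext fun x => e.symm_apply_apply x
  have hs' : p.hom.comp (e.symm : H' →ₐ[k] H) = AlgHom.id k H' :=
    AlgHom.ext fun x => e.apply_symm_apply x
  refine ⟨hp, p.inv e, .of_legs (hp.data.inv he) ?_, Pair.ext hs ?_, Pair.ext hs' ?_⟩
  · have h := hp.ev_comp ((inl k H H).comp (e.symm : H' →ₐ[k] H))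
      ((inr k H H).comp (e.symm : H' →ₐ[k] H)) ((commHom_inl_inr.comp_left _).comp_right _)
    simp only [comp_symm_comp he] at h
    rw [ev_inv_elt, ev_inv_elt, h]
    simp only [Pair.inv]
    group
  · rw [← ev_inl_inr ((p.inv e).comp p).elt, ev_comp_elt, ev_inv_elt]
    exact mul_inv_cancel _
  · rw [← ev_inl_inr (p.comp (p.inv e)).elt, ev_comp_elt, ev_inv_elt]
    simp only [AlgHom.comp_assoc, hs', AlgHom.comp_id]
    exact inv_mul_cancel _

end Composition

/-! ### Transport of triangular structures along surjective twisted morphisms -/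

section Pushforward

variable {H : Type*} [Ring H] [Bialgebra k H]
variable {H' : Type*} [Ring H'] [Bialgebra k H']
variable {A : Type*} [Ring A] [Algebra k A]

/-- The element `R'` with `(f ⊗ f)(R) = R'_F`. -/
def Pair.push (p : Pair k H H') (R : (H ⊗[k] H)ˣ) : (H' ⊗[k] H')ˣ :=
  (opUnit p.elt)⁻¹ *
    Units.map (Algebra.TensorProduct.map p.hom p.hom : H ⊗[k] H →* H' ⊗[k] H') R * p.elt

theorem IsTwCellData.isTwTrCell_push {p : Pair k H H'} (hp : IsTwCellData p) (R : (H ⊗[k] H)ˣ) :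
    IsTwTrCell R (p.push R) p :=
  isTwTrCell_iff.2 ⟨hp, by simp only [Pair.push]; group⟩

theorem ev_push (p : Pair k H H') (R : (H ⊗[k] H)ˣ) (a b : H' →ₐ[k] A) (h : CommHom a b) :
    ev a b h (p.push R) = (ev b a h.symm p.elt)⁻¹ *
      ev (a.comp p.hom) (b.comp p.hom) ((h.comp_left p.hom).comp_right p.hom) R *
        ev a b h p.elt := by
  rw [Pair.push, ev_mul, ev_mul, ev_inv, ev_opUnit, ev_comp_comp]

variable {p : Pair k H H'} {R : (H ⊗[k] H)ˣ}

/-- Surjectivity enters here: quasi-cocommutativity of R is known only on the image of f, where it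
is conjugated by F(b, a) on one side and by F(a, b) on the other. -/
theorem IsTwCellData.conv_swap_mul_push (hp : IsTwCellData p) (hs : Function.Surjective p.hom)
    (hR : IsTriangular R) (a b : H' →ₐ[k] A) (h : CommHom a b) (y : H') :
    conv b a h.symm y * ev a b h (p.push R) = ev a b h (p.push R) * conv a b h y := by
  obtain ⟨x, rfl⟩ := hs y
  have h1 := hp.conv_mul a b h x
  have h2 := hp.conv_mul b a h.symm x
  have h3 := hR.conv_swap_mul (a.comp p.hom) (b.comp p.hom)
    ((h.comp_left p.hom).comp_right p.hom) x
  have h2' : conv b a h.symm (p.hom x) * ((ev b a h.symm p.elt)⁻¹ : Aˣ) =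
      ((ev b a h.symm p.elt)⁻¹ : Aˣ) * conv (b.comp p.hom) (a.comp p.hom)
        ((h.symm.comp_left p.hom).comp_right p.hom) x := by
    rw [Units.eq_inv_mul_iff_mul_eq, ← mul_assoc, ← h2, mul_assoc, Units.mul_inv, mul_one]
  rw [ev_push, Units.val_mul, Units.val_mul, ← mul_assoc, ← mul_assoc, h2',
    mul_assoc _ (conv _ _ _ _), h3]
  simp only [mul_assoc]
  rw [h1]

/-- The identity between values of a twist `F` and of a quasi-commutative `R` from which the hexagon
equation for `R` follows. -/
theorem hexagon_of_cocycles {G : Type*} [Group G]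
    {Fab Fba Fbc Fac Fca F₁ F₂ F₃ F₄ F₅ F₆ Sac Sab S Rab Rac : G}
    (e1 : Sac * Sab * Fbc = Fbc * S) (e2 : Fab * F₁ = Fbc * F₂) (e3 : F₃ * Rab = Rab * F₁)
    (e4 : Fba * F₃ = Fac * F₄) (e5 : F₅ * Rac = Rac * F₄) (e6 : Fbc * F₆ = Fca * F₅)
    (r1 : Rab = Fba⁻¹ * Sab * Fab) (r2 : Rac = Fca⁻¹ * Sac * Fac) :
    F₆⁻¹ * S * F₂ = Rac * Rab := by
  -- Each relation expresses one variable through the others; after the substitutions the claim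
  -- holds in the free group.
  obtain rfl : S = Fbc⁻¹ * (Sac * Sab * Fbc) := by rw [e1]; group
  obtain rfl : F₂ = Fbc⁻¹ * (Fab * F₁) := by rw [e2]; group
  obtain rfl : F₁ = Rab⁻¹ * (F₃ * Rab) := by rw [e3]; group
  obtain rfl : F₆ = Fbc⁻¹ * (Fca * F₅) := by rw [← e6]; group
  obtain rfl : F₅ = Rac * F₄ * Rac⁻¹ := by rw [← e5]; group
  obtain rfl : F₄ = Fac⁻¹ * (Fba * F₃) := by rw [e4]; group
  subst r1 r2
  group

/-- The order (a, b, c) is changed to (b, a, c) and then to (b, c, a), with the cocycle equation of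
F at each order. The transported R(a, b) and R(a, c) convert the values of F at convolutions between
consecutive orders, and the hexagon of R supplies the remaining relation. -/
theorem IsTwCellData.push_hexagon_right (hp : IsTwCellData p) (hs : Function.Surjective p.hom)
    (hR : IsTriangular R) (a b c : H' →ₐ[k] A)
    (hab : CommHom a b) (hac : CommHom a c) (hbc : CommHom b c) :
    ev a (conv b c hbc) (hbc.conv_right hab hac) (p.push R) =
      ev a c hac (p.push R) * ev a b hab (p.push R) := by
  have e1 := hp.ev_conv_right a b c hab hac hbc R
  rw [hR.ev_conv_right (a.comp p.hom) (b.comp p.hom) (c.comp p.hom)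
    ((hab.comp_left p.hom).comp_right p.hom) ((hac.comp_left p.hom).comp_right p.hom)
    ((hbc.comp_left p.hom).comp_right p.hom)] at e1
  have e2 := hp.isTwist.ev_cocycle a b c hab hac hbc
  have e3 := ev_mul_left_of_conj (hab.symm.conv_left hbc hac) (hab.conv_left hac hbc)
    (ev a b hab (p.push R)) (hp.conv_swap_mul_push hs hR a b hab)
    (commute_hom_ev hab hac hbc _) p.elt
  have e4 := hp.isTwist.ev_cocycle b a c hab.symm hbc hac
  have e5 := ev_mul_right_of_conj (hac.symm.conv_right hbc hab.symm)
    (hac.conv_right hab.symm hbc)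
    (ev a c hac (p.push R)) (hp.conv_swap_mul_push hs hR a c hac)
    (commute_hom_ev hac hab hbc.symm _) p.elt
  have e6 := hp.isTwist.ev_cocycle b c a hbc hab.symm hac.symm
  rw [ev_push p R a (conv b c hbc) (hbc.conv_right hab hac)]
  exact hexagon_of_cocycles e1 e2 e3 e4 e5 e6 (ev_push p R a b hab) (ev_push p R a c hac)

theorem IsTwCellData.isTriangular_push (hp : IsTwCellData p) (hs : Function.Surjective p.hom)
    (hR : IsTriangular R) : IsTriangular (p.push R) := by
  have hsw : ∀ {A : Type _} [Ring A] [Algebra k A] (a b : H' →ₐ[k] A) (h : CommHom a b),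
      ev b a h.symm (p.push R) = (ev a b h (p.push R))⁻¹ := by
    intro A _ _ a b h
    rw [ev_push, ev_push, hR.ev_swap _ _ ((h.comp_left p.hom).comp_right p.hom)]
    group
  refine .of_legs (hp.conv_swap_mul_push hs hR _ _ _)
    (hp.push_hexagon_right hs hR _ _ _ commHom_leg₁₂ commHom_leg₁₃ commHom_leg₂₃) ?_ ?_
  -- Since R(x, y)⁻¹ = R(y, x), inverting the second hexagon gives the first one at the legs in the
  -- order (3, 1, 2).
  · rw [← inv_inj, mul_inv_rev, ← hsw, ← hsw, ← hsw]
    exact hp.push_hexagon_right hs hR _ _ _ commHom_leg₁₃.symm commHom_leg₂₃.symm commHom_leg₁₂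
  · rw [← ev_inr_inl, hsw _ _ commHom_inl_inr, ev_inl_inr]

end Pushforward

/-! ### Algebra maps out of a tensor product of bialgebras -/

section TensorProduct

variable {H₁ : Type*} [Ring H₁] [Bialgebra k H₁]
variable {H₂ : Type*} [Ring H₂] [Bialgebra k H₂]
variable {A : Type*} [Ring A] [Algebra k A]

theorem commHom_comp_inl_inr (a : H₁ ⊗[k] H₂ →ₐ[k] A) :
    CommHom (a.comp (inl k H₁ H₂)) (a.comp (inr k H₁ H₂)) :=
  commHom_inl_inr.map a

theorem eq_lift (a : H₁ ⊗[k] H₂ →ₐ[k] A) :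
    a = Algebra.TensorProduct.lift (a.comp (inl k H₁ H₂)) (a.comp (inr k H₁ H₂))
      (commHom_comp_inl_inr a) := by
  rw [← comp_lift a _ _ commHom_inl_inr, lift_inl_inr, AlgHom.comp_id]

/-- The inclusion of `H₁` commutes with comultiplication. Together with the analogue for `H₂`, this
reduces convolutions on the tensor product to convolutions on the factors. -/
theorem conv_comp_inl (a b : H₁ ⊗[k] H₂ →ₐ[k] A) (h : CommHom a b) :
    (conv a b h).comp (inl k H₁ H₂) = conv (a.comp (inl k H₁ H₂)) (b.comp (inl k H₁ H₂))
      ((h.comp_left _).comp_right _) := by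
  have : (Bialgebra.comulAlgHom k (H₁ ⊗[k] H₂)).comp (inl k H₁ H₂) =
      (Algebra.TensorProduct.map (inl k H₁ H₂) (inl k H₁ H₂)).comp
        (Bialgebra.comulAlgHom k H₁) := by
    have h2 : (Algebra.TensorProduct.tensorTensorTensorComm k k k k H₁ H₁ H₂ H₂ :
        (H₁ ⊗[k] H₁) ⊗[k] (H₂ ⊗[k] H₂) →ₐ[k] (H₁ ⊗[k] H₂) ⊗[k] (H₁ ⊗[k] H₂)).comp
        (Algebra.TensorProduct.includeLeft) =
        Algebra.TensorProduct.map (inl k H₁ H₂) (inl k H₁ H₂) := by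
      ext <;> simp [Algebra.TensorProduct.one_def]
    rw [← h2]
    ext x
    simp [Bialgebra.TensorProduct.comulAlgHom_def, -Bialgebra.comulAlgHom_apply]
  rw [conv, AlgHom.comp_assoc, this, ← AlgHom.comp_assoc, lift_comp_map, conv]

theorem conv_comp_inr (a b : H₁ ⊗[k] H₂ →ₐ[k] A) (h : CommHom a b) :
    (conv a b h).comp (inr k H₁ H₂) = conv (a.comp (inr k H₁ H₂)) (b.comp (inr k H₁ H₂))
      ((h.comp_left _).comp_right _) := by
  have : (Bialgebra.comulAlgHom k (H₁ ⊗[k] H₂)).comp (inr k H₁ H₂) =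
      (Algebra.TensorProduct.map (inr k H₁ H₂) (inr k H₁ H₂)).comp
        (Bialgebra.comulAlgHom k H₂) := by
    have h2 : (Algebra.TensorProduct.tensorTensorTensorComm k k k k H₁ H₁ H₂ H₂ :
        (H₁ ⊗[k] H₁) ⊗[k] (H₂ ⊗[k] H₂) →ₐ[k] (H₁ ⊗[k] H₂) ⊗[k] (H₁ ⊗[k] H₂)).comp
        (Algebra.TensorProduct.includeRight) =
        Algebra.TensorProduct.map (inr k H₁ H₂) (inr k H₁ H₂) := by
      ext <;> simp [Algebra.TensorProduct.one_def]
    rw [← h2]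
    ext x
    simp [Bialgebra.TensorProduct.comulAlgHom_def, -Bialgebra.comulAlgHom_apply]
  rw [conv, AlgHom.comp_assoc, this, ← AlgHom.comp_assoc, lift_comp_map, conv]

theorem convUnit_comp_inl : (convUnit k (H₁ ⊗[k] H₂) A).comp (inl k H₁ H₂) = convUnit k H₁ A := by
  ext x
  simp [convUnit, Bialgebra.TensorProduct.counitAlgHom_def, -Bialgebra.counitAlgHom_apply]

theorem convUnit_comp_inr : (convUnit k (H₁ ⊗[k] H₂) A).comp (inr k H₁ H₂) = convUnit k H₂ A := by
  ext x
  simp [convUnit, Bialgebra.TensorProduct.counitAlgHom_def, -Bialgebra.counitAlgHom_apply]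

theorem ev_middle (a b : H₁ ⊗[k] H₂ →ₐ[k] A) (h : CommHom a b) (T₁ : (H₁ ⊗[k] H₁)ˣ)
    (T₂ : (H₂ ⊗[k] H₂)ˣ) :
    ev a b h (middle T₁ T₂) =
      ev (a.comp (inl k H₁ H₂)) (b.comp (inl k H₁ H₂)) ((h.comp_left _).comp_right _) T₁ *
      ev (a.comp (inr k H₁ H₂)) (b.comp (inr k H₁ H₂)) ((h.comp_left _).comp_right _) T₂ := by
  have h1 : ((Algebra.TensorProduct.lift a b h).comp
      (Algebra.TensorProduct.tensorTensorTensorComm k k k k H₁ H₁ H₂ H₂ :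
        (H₁ ⊗[k] H₁) ⊗[k] (H₂ ⊗[k] H₂) →ₐ[k] (H₁ ⊗[k] H₂) ⊗[k] (H₁ ⊗[k] H₂))).comp
      (Algebra.TensorProduct.includeLeft) =
      Algebra.TensorProduct.lift (a.comp (inl k H₁ H₂)) (b.comp (inl k H₁ H₂))
        ((h.comp_left _).comp_right _) := by
    ext <;> simp [Algebra.TensorProduct.one_def] <;> simp [← Algebra.TensorProduct.one_def]
  have h2 : ((Algebra.TensorProduct.lift a b h).comp
      (Algebra.TensorProduct.tensorTensorTensorComm k k k k H₁ H₁ H₂ H₂ :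
        (H₁ ⊗[k] H₁) ⊗[k] (H₂ ⊗[k] H₂) →ₐ[k] (H₁ ⊗[k] H₂) ⊗[k] (H₁ ⊗[k] H₂))).comp
      (Algebra.TensorProduct.includeRight) =
      Algebra.TensorProduct.lift (a.comp (inr k H₁ H₂)) (b.comp (inr k H₁ H₂))
        ((h.comp_left _).comp_right _) := by
    ext <;> simp [Algebra.TensorProduct.one_def] <;> simp [← Algebra.TensorProduct.one_def]
  refine Units.ext ?_
  rw [Units.val_mul, ev_val, ev_val, ev_val, ← h1, ← h2, middle_val]
  have h3 : (T₁ : H₁ ⊗[k] H₁) ⊗ₜ[k] (T₂ : H₂ ⊗[k] H₂) =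
      Algebra.TensorProduct.includeLeft (R := k) (S := k) (T₁ : H₁ ⊗[k] H₁) *
        Algebra.TensorProduct.includeRight (R := k) (T₂ : H₂ ⊗[k] H₂) := by simp
  rw [h3, map_mul, map_mul]
  rfl

theorem commute_ev_ev {K₁ K₂ L₁ L₂ : Type*} [Ring K₁] [Algebra k K₁] [Ring K₂] [Algebra k K₂]
    [Ring L₁] [Algebra k L₁] [Ring L₂] [Algebra k L₂]
    {a : K₁ →ₐ[k] A} {b : K₂ →ₐ[k] A} {c : L₁ →ₐ[k] A} {d : L₂ →ₐ[k] A} (hab : CommHom a b)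
    (hcd : CommHom c d) (hac : CommHom a c) (had : CommHom a d) (hbc : CommHom b c)
    (hbd : CommHom b d) (S : (K₁ ⊗[k] K₂)ˣ) (T : (L₁ ⊗[k] L₂)ˣ) :
    Commute (ev a b hab S) (ev c d hcd T) :=
  commute_ev hab (commute_hom_ev hcd hac.symm had.symm T) (commute_hom_ev hcd hbc.symm hbd.symm T) S

/-- An intertwining relation between algebra maps passes to products, so it may be checked on the
two factors, which generate the tensor product. -/
theorem mul_eq_mul_of_inl_inr {α β : H₁ ⊗[k] H₂ →ₐ[k] A} {z : A}
    (hl : ∀ x, α.comp (inl k H₁ H₂) x * z = z * β.comp (inl k H₁ H₂) x)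
    (hr : ∀ x, α.comp (inr k H₁ H₂) x * z = z * β.comp (inr k H₁ H₂) x) (x : H₁ ⊗[k] H₂) :
    α x * z = z * β x := by
  induction x with
  | zero => simp
  | tmul x y =>
    have h : x ⊗ₜ[k] y = inl k H₁ H₂ x * inr k H₁ H₂ y := by simp
    rw [h, map_mul, map_mul, mul_assoc]
    refine (congrArg (α _ * ·) (hr y)).trans ?_
    rw [← mul_assoc]
    refine (congrArg (· * _) (hl x)).trans ?_
    rw [mul_assoc]; rfl
  | add x y hx hy => simp only [map_add, add_mul, mul_add, hx, hy]

/-! ### Tensor products of twisted morphisms -/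

variable {K₁ : Type*} [Ring K₁] [Bialgebra k K₁]
variable {K₂ : Type*} [Ring K₂] [Bialgebra k K₂]

/-- The tensor product of two twisted morphisms. -/
def Pair.tensor (p₁ : Pair k K₁ H₁) (p₂ : Pair k K₂ H₂) : Pair k (K₁ ⊗[k] K₂) (H₁ ⊗[k] H₂) :=
  ⟨Algebra.TensorProduct.map p₁.hom p₂.hom, middle p₁.elt p₂.elt⟩

variable {p₁ : Pair k K₁ H₁} {p₂ : Pair k K₂ H₂}

theorem comp_tensor_inl (a : H₁ ⊗[k] H₂ →ₐ[k] A) :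
    (a.comp (p₁.tensor p₂).hom).comp (inl k K₁ K₂) = (a.comp (inl k H₁ H₂)).comp p₁.hom := by
  ext; simp [Pair.tensor]

theorem comp_tensor_inr (a : H₁ ⊗[k] H₂ →ₐ[k] A) :
    (a.comp (p₁.tensor p₂).hom).comp (inr k K₁ K₂) = (a.comp (inr k H₁ H₂)).comp p₂.hom := by
  ext; simp [Pair.tensor]

/-- Each value splits into a value of F₁ on the first factor and one of F₂ on the second. These
commute, so the equation is the product of the two separate cocycle equations. -/
theorem middle_cocycle {F₁ : (H₁ ⊗[k] H₁)ˣ} {F₂ : (H₂ ⊗[k] H₂)ˣ} (h₁ : IsTwist F₁)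
    (h₂ : IsTwist F₂) (a b c : H₁ ⊗[k] H₂ →ₐ[k] A) (hab : CommHom a b) (hac : CommHom a c)
    (hbc : CommHom b c) :
    ev a b hab (middle F₁ F₂) * ev (conv a b hab) c (hab.conv_left hac hbc) (middle F₁ F₂) =
      ev b c hbc (middle F₁ F₂) * ev a (conv b c hbc) (hbc.conv_right hab hac) (middle F₁ F₂) := by
  have comm : ∀ {x y : H₁ ⊗[k] H₂ →ₐ[k] A}, CommHom x y →
      CommHom (x.comp (inr k H₁ H₂)) (y.comp (inl k H₁ H₂)) :=
    fun h => (h.comp_left _).comp_right _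
  have self : ∀ x : H₁ ⊗[k] H₂ →ₐ[k] A,
      CommHom (x.comp (inr k H₁ H₂)) (x.comp (inl k H₁ H₂)) :=
    fun x => (commHom_comp_inl_inr x).symm
  simp only [ev_middle, conv_comp_inl, conv_comp_inr]
  have e1 := h₁.ev_cocycle (a.comp (inl k H₁ H₂)) (b.comp (inl k H₁ H₂)) (c.comp (inl k H₁ H₂))
    ((hab.comp_left _).comp_right _) ((hac.comp_left _).comp_right _)
    ((hbc.comp_left _).comp_right _)
  have e2 := h₂.ev_cocycle (a.comp (inr k H₁ H₂)) (b.comp (inr k H₁ H₂)) (c.comp (inr k H₁ H₂))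
    ((hab.comp_left _).comp_right _) ((hac.comp_left _).comp_right _)
    ((hbc.comp_left _).comp_right _)
  have c1 := commute_ev_ev (k := k) ((hab.comp_left (inr k H₁ H₂)).comp_right (inr k H₁ H₂))
    (CommHom.conv_left ((hab.comp_left (inl k H₁ H₂)).comp_right (inl k H₁ H₂))
      ((hac.comp_left (inl k H₁ H₂)).comp_right (inl k H₁ H₂))
      ((hbc.comp_left (inl k H₁ H₂)).comp_right (inl k H₁ H₂)))
    (CommHom.conv_right _ (self a) (comm hab)) (comm hac)
    (CommHom.conv_right _ (comm hab.symm) (self b)) (comm hbc) F₂ F₁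
  have c2 := commute_ev_ev (k := k) ((hbc.comp_left (inr k H₁ H₂)).comp_right (inr k H₁ H₂))
    (CommHom.conv_right ((hbc.comp_left (inl k H₁ H₂)).comp_right (inl k H₁ H₂))
      ((hab.comp_left (inl k H₁ H₂)).comp_right (inl k H₁ H₂))
      ((hac.comp_left (inl k H₁ H₂)).comp_right (inl k H₁ H₂)))
    (comm hab.symm) (CommHom.conv_right _ (self b) (comm hbc))
    (comm hac.symm) (CommHom.conv_right _ (comm hbc.symm) (self c)) F₂ F₁
  rw [c1.mul_mul_mul_comm, c2.mul_mul_mul_comm, e1, e2]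

theorem IsTwist.middle {F₁ : (H₁ ⊗[k] H₁)ˣ} {F₂ : (H₂ ⊗[k] H₂)ˣ} (h₁ : IsTwist F₁)
    (h₂ : IsTwist F₂) : IsTwist (middle F₁ F₂) := by
  refine .of_legs (middle_cocycle h₁ h₂ _ _ _ commHom_leg₁₂ commHom_leg₁₃ commHom_leg₂₃) ?_ ?_
  · simp only [ev_middle, convUnit_comp_inl, convUnit_comp_inr, h₁.ev_counit_left,
      h₂.ev_counit_left, mul_one]
  · simp only [ev_middle, convUnit_comp_inl, convUnit_comp_inr, h₁.ev_counit_right,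
      h₂.ev_counit_right, mul_one]

/-- On each factor, the twist belonging to the other factor commutes with everything, which leaves
the relation for a single 1-cell. -/
theorem tensor_conv_mul (h₁ : IsTwCellData p₁) (h₂ : IsTwCellData p₂) (a b : H₁ ⊗[k] H₂ →ₐ[k] A)
    (h : CommHom a b) (x : K₁ ⊗[k] K₂) :
    conv (a.comp (p₁.tensor p₂).hom) (b.comp (p₁.tensor p₂).hom)
        ((h.comp_left _).comp_right _) x * ev a b h (p₁.tensor p₂).elt =
      ev a b h (p₁.tensor p₂).elt * conv a b h ((p₁.tensor p₂).hom x) := by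
  have hl := (h.comp_left (inl k H₁ H₂)).comp_right (inl k H₁ H₂)
  have hr := (h.comp_left (inr k H₁ H₂)).comp_right (inr k H₁ H₂)
  have c1 := commHom_comp_inl_inr a
  have c2 := commHom_comp_inl_inr b
  have c3 := (h.comp_left (inl k H₁ H₂)).comp_right (inr k H₁ H₂)
  have c4 := (h.symm.comp_left (inl k H₁ H₂)).comp_right (inr k H₁ H₂)
  have e : (p₁.tensor p₂).elt = middle p₁.elt p₂.elt := rfl
  rw [e, ev_middle a b h]
  refine mul_eq_mul_of_inl_inr (β := (conv a b h).comp (p₁.tensor p₂).hom) ?_ ?_ x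
  · intro y
    simp only [conv_comp_inl, comp_tensor_inl, Units.val_mul]
    rw [← mul_assoc]
    refine (congrArg (· * _) (h₁.conv_mul _ _ hl y)).trans ?_
    rw [mul_assoc, mul_assoc]
    exact congrArg _ (commute_hom_ev hr (hl.conv_right c1.symm c4.symm)
      (hl.conv_right c3.symm c2.symm) _ _)
  · intro y
    simp only [conv_comp_inr, comp_tensor_inr, Units.val_mul]
    have hc := commute_hom_ev hl (((hr.comp_left p₂.hom).comp_right p₂.hom).conv_right
      (c1.comp_right p₂.hom) (c3.comp_right p₂.hom))
      (((hr.comp_left p₂.hom).comp_right p₂.hom).conv_right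
      (c4.comp_right p₂.hom) (c2.comp_right p₂.hom)) p₁.elt y
    rw [← mul_assoc, hc, mul_assoc, mul_assoc]
    exact congrArg _ (h₂.conv_mul _ _ hr y)

theorem IsTwCellData.tensor (h₁ : IsTwCellData p₁) (h₂ : IsTwCellData p₂) :
    IsTwCellData (p₁.tensor p₂) := by
  refine .of_legs (h₁.isTwist.middle h₂.isTwist) (tensor_conv_mul h₁ h₂ _ _ _) ?_
  rw [eq_lift ((convUnit k (H₁ ⊗[k] H₂) k).comp (p₁.tensor p₂).hom),
    eq_lift (convUnit k (K₁ ⊗[k] K₂) k)]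
  simp only [comp_tensor_inl, comp_tensor_inr, convUnit_comp_inl, convUnit_comp_inr,
    h₁.convUnit_comp, h₂.convUnit_comp]

theorem mul_mul_inv_mul_comm {G : Type*} [Group G] {x y z x' y' z' : G} (h₁ : Commute x' y)
    (h₂ : Commute x' z) (h₃ : Commute y' z) (h₄ : Commute z' z) :
    x * y * z⁻¹ * (x' * y' * z'⁻¹) = x * x' * (y * y') * (z * z')⁻¹ := by
  have h : Commute (z⁻¹) (x' * y' * z'⁻¹) :=
    ((h₂.mul_left h₃).mul_left h₄.inv_left).symm.inv_left
  rw [mul_assoc (x * y), h, ← mul_assoc, ← mul_assoc, ← mul_assoc, mul_assoc x, ← h₁, mul_inv_rev]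
  simp only [mul_assoc]

theorem IsTwTrCell.tensor {R₁ : (K₁ ⊗[k] K₁)ˣ} {R₂ : (K₂ ⊗[k] K₂)ˣ} {S₁ : (H₁ ⊗[k] H₁)ˣ}
    {S₂ : (H₂ ⊗[k] H₂)ˣ} (h₁ : IsTwTrCell R₁ S₁ p₁) (h₂ : IsTwTrCell R₂ S₂ p₂) :
    IsTwTrCell (middle R₁ R₂) (middle S₁ S₂) (p₁.tensor p₂) := by
  refine .of_legs (h₁.data.tensor h₂.data) ?_
  have key : ∀ {A : Type _} [Ring A] [Algebra k A] (a b : H₁ ⊗[k] H₂ →ₐ[k] A) (h : CommHom a b),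
      ev (a.comp (p₁.tensor p₂).hom) (b.comp (p₁.tensor p₂).hom) ((h.comp_left _).comp_right _)
        (middle R₁ R₂) = ev b a h.symm (p₁.tensor p₂).elt * ev a b h (middle S₁ S₂) *
          (ev a b h (p₁.tensor p₂).elt)⁻¹ := by
    intro A _ _ a b h
    have e : (p₁.tensor p₂).elt = middle p₁.elt p₂.elt := rfl
    have hl := (h.comp_left (inl k H₁ H₂)).comp_right (inl k H₁ H₂)
    have hr := (h.comp_left (inr k H₁ H₂)).comp_right (inr k H₁ H₂)
    have c1 := (commHom_comp_inl_inr a).symm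
    have c2 := (commHom_comp_inl_inr b).symm
    have c3 := (h.comp_left (inr k H₁ H₂)).comp_right (inl k H₁ H₂)
    have c4 := (h.symm.comp_left (inr k H₁ H₂)).comp_right (inl k H₁ H₂)
    rw [ev_middle]
    simp only [comp_tensor_inl, comp_tensor_inr]
    rw [h₁.ev_comp _ _ hl, h₂.ev_comp _ _ hr]
    -- The two conjugated R-matrices are interleaved; all the commutations needed are between a
    -- value on the first factor and one on the second.
    refine (mul_mul_inv_mul_comm ?_ ?_ ?_ ?_).trans ?_
    · exact commute_ev_ev hr.symm hl c4 c2 c1 c3 _ _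
    · exact commute_ev_ev hr.symm hl c4 c2 c1 c3 _ _
    · exact commute_ev_ev hr hl c1 c3 c4 c2 _ _
    · exact commute_ev_ev hr hl c1 c3 c4 c2 _ _
    · rw [e, ev_middle b a h.symm, ev_middle a b h, ev_middle a b h]
  exact key _ _ _

/-! ### The projections of a tensor product -/

variable (k H₁ H₂) in
/-- `Id ⊗ ε`, as a twisted morphism. -/
def projLeft : Pair k (H₁ ⊗[k] H₂) H₁ :=
  ⟨Algebra.TensorProduct.lift (AlgHom.id k H₁) (convUnit k H₂ H₁) (commHom_convUnit_right _), 1⟩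

variable (k H₁ H₂) in
/-- `ε ⊗ Id`, as a twisted morphism. -/
def projRight : Pair k (H₁ ⊗[k] H₂) H₂ :=
  ⟨Algebra.TensorProduct.lift (convUnit k H₁ H₂) (AlgHom.id k H₂) (commHom_convUnit_left _), 1⟩

theorem comp_projLeft_inl (a : H₁ →ₐ[k] A) :
    (a.comp (projLeft k H₁ H₂).hom).comp (inl k H₁ H₂) = a := by
  ext; simp [projLeft]

theorem comp_projLeft_inr (a : H₁ →ₐ[k] A) :
    (a.comp (projLeft k H₁ H₂).hom).comp (inr k H₁ H₂) = convUnit k H₂ A := by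
  ext; simp [projLeft, convUnit, Algebra.ofId_apply]

theorem comp_projRight_inl (a : H₂ →ₐ[k] A) :
    (a.comp (projRight k H₁ H₂).hom).comp (inl k H₁ H₂) = convUnit k H₁ A := by
  ext; simp [projRight, convUnit, Algebra.ofId_apply]

theorem comp_projRight_inr (a : H₂ →ₐ[k] A) :
    (a.comp (projRight k H₁ H₂).hom).comp (inr k H₁ H₂) = a := by
  ext; simp [projRight]

theorem isTwist_one : IsTwist (1 : (H₁ ⊗[k] H₁)ˣ) :=
  .of_legs (by simp only [ev_one]) (ev_one _ _ _) (ev_one _ _ _)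

theorem isTwCellData_projLeft : IsTwCellData (projLeft k H₁ H₂) := by
  have e : (projLeft k H₁ H₂).elt = 1 := rfl
  refine .of_legs isTwist_one (mul_eq_mul_of_inl_inr
    (β := (conv _ _ commHom_inl_inr).comp (projLeft k H₁ H₂).hom) ?_ ?_) ?_
  · simp [conv_comp_inl, comp_projLeft_inl, e, ev_one]
  · simp [conv_comp_inr, comp_projLeft_inr, conv_convUnit_left, e, ev_one]
  · rw [eq_lift ((convUnit k H₁ k).comp (projLeft k H₁ H₂).hom),
      eq_lift (convUnit k (H₁ ⊗[k] H₂) k)]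
    simp only [comp_projLeft_inl, comp_projLeft_inr, convUnit_comp_inl, convUnit_comp_inr]

theorem isTwCellData_projRight : IsTwCellData (projRight k H₁ H₂) := by
  have e : (projRight k H₁ H₂).elt = 1 := rfl
  refine .of_legs isTwist_one (mul_eq_mul_of_inl_inr
    (β := (conv _ _ commHom_inl_inr).comp (projRight k H₁ H₂).hom) ?_ ?_) ?_
  · simp [conv_comp_inl, comp_projRight_inl, conv_convUnit_left, e, ev_one]
  · simp [conv_comp_inr, comp_projRight_inr, e, ev_one]
  · rw [eq_lift ((convUnit k H₂ k).comp (projRight k H₁ H₂).hom),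
      eq_lift (convUnit k (H₁ ⊗[k] H₂) k)]
    simp only [comp_projRight_inl, comp_projRight_inr, convUnit_comp_inl, convUnit_comp_inr]

/-- The factor coming from R₂ is evaluated at (ε, ε) and vanishes by the normalisation (ε ⊗ Id)(R₂)
= 1. -/
theorem isTwTrCell_projLeft (R₁ : (H₁ ⊗[k] H₁)ˣ) {R₂ : (H₂ ⊗[k] H₂)ˣ} (hR₂ : IsTriangular R₂) :
    IsTwTrCell (middle R₁ R₂) R₁ (projLeft k H₁ H₂) := by
  have e : (projLeft k H₁ H₂).elt = 1 := rfl
  refine .of_legs isTwCellData_projLeft ?_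
  simp only [ev_middle, comp_projLeft_inl, comp_projLeft_inr, hR₂.ev_counit_left, e, ev_one,
    mul_one, one_mul, inv_one]

theorem isTwTrCell_projRight {R₁ : (H₁ ⊗[k] H₁)ˣ} (R₂ : (H₂ ⊗[k] H₂)ˣ) (hR₁ : IsTriangular R₁) :
    IsTwTrCell (middle R₁ R₂) R₂ (projRight k H₁ H₂) := by
  have e : (projRight k H₁ H₂).elt = 1 := rfl
  refine .of_legs isTwCellData_projRight ?_
  simp only [ev_middle, comp_projRight_inl, comp_projRight_inr, hR₁.ev_counit_left, e, ev_one,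
    mul_one, one_mul, inv_one]

theorem projLeft_surjective : Function.Surjective (projLeft k H₁ H₂).hom :=
  fun x => ⟨x ⊗ₜ 1, by simp [projLeft]⟩

theorem projRight_surjective : Function.Surjective (projRight k H₁ H₂).hom :=
  fun x => ⟨1 ⊗ₜ x, by simp [projRight]⟩

/-- On either factor one of the two maps becomes ε, the neutral element of convolution. This is why
the two components recover a morphism into the tensor product up to conjugation. -/
theorem conv_proj :
    conv ((inl k H₁ H₂).comp (projLeft k H₁ H₂).hom) ((inr k H₁ H₂).comp (projRight k H₁ H₂).hom)
      ((commHom_inl_inr.comp_left _).comp_right _) = AlgHom.id k (H₁ ⊗[k] H₂) := by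
  refine (eq_lift _).trans ?_
  simp only [conv_comp_inl, conv_comp_inr, comp_projLeft_inl, comp_projLeft_inr,
    comp_projRight_inl, comp_projRight_inr, conv_convUnit_left, conv_convUnit_right, lift_inl_inr]

end TensorProduct

/-! ### The comultiplication as a twisted morphism -/

section Comul

variable {H : Type*} [Ring H] [Bialgebra k H]
variable {A : Type*} [Ring A] [Algebra k A]

/-- The pair `(Δ, 1 ⊗ R⁻¹ ⊗ 1)`. -/
def comulPair (R : (H ⊗[k] H)ˣ) : Pair k H (H ⊗[k] H) :=
  ⟨Bialgebra.comulAlgHom k H, Units.map (Algebra.TensorProduct.map (inr k H H) (inl k H H) :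
    H ⊗[k] H →* (H ⊗[k] H) ⊗[k] (H ⊗[k] H)) R⁻¹⟩

theorem ev_comulPair_elt (R : (H ⊗[k] H)ˣ) (a b : H ⊗[k] H →ₐ[k] A) (h : CommHom a b) :
    ev a b h (comulPair R).elt =
      (ev (a.comp (inr k H H)) (b.comp (inl k H H)) ((h.comp_left _).comp_right _) R)⁻¹ := by
  rw [← ev_inv]
  exact ev_map a b h _ _ _

theorem comp_comulPair (R : (H ⊗[k] H)ˣ) (a : H ⊗[k] H →ₐ[k] A) :
    a.comp (comulPair R).hom =
      conv (a.comp (inl k H H)) (a.comp (inr k H H)) (commHom_comp_inl_inr a) := by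
  rw [conv, ← eq_lift]; rfl

/-- Reassociation isolates the middle pair, which is where Δ fails to be a coalgebra map. -/
theorem conv_conv_conv (a b c d : H →ₐ[k] A) (hab : CommHom a b) (hac : CommHom a c)
    (had : CommHom a d) (hbc : CommHom b c) (hbd : CommHom b d) (hcd : CommHom c d) :
    conv (conv a b hab) (conv c d hcd)
        (hcd.conv_right (hab.conv_left hac hbc) (hab.conv_left had hbd)) =
      conv a (conv (conv b c hbc) d (hbc.conv_left hbd hcd))
        (CommHom.conv_right _ (hbc.conv_right hab hac) had) := by
  rw [conv_assoc a b (conv c d hcd) hab (hcd.conv_right hac had) (hcd.conv_right hbc hbd)]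
  simp only [conv_assoc b c d hbc hbd hcd]

variable {R : (H ⊗[k] H)ˣ}

/-- Write l and r for restriction to the two factors. By the hexagons both sides are products of the
inverses of R(a_r, b_l), R(b_r, c_l) and R(a_r, c_l), with the last inverse at the end; the other
two commute because b_l and b_r do. -/
theorem comulPair_cocycle (hR : IsTriangular R) (a b c : H ⊗[k] H →ₐ[k] A) (hab : CommHom a b)
    (hac : CommHom a c) (hbc : CommHom b c) :
    ev a b hab (comulPair R).elt *
        ev (conv a b hab) c (hab.conv_left hac hbc) (comulPair R).elt =
      ev b c hbc (comulPair R).elt *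
        ev a (conv b c hbc) (hbc.conv_right hab hac) (comulPair R).elt := by
  have ab := fun (f g : H →ₐ[k] H ⊗[k] H) => (hab.comp_left f).comp_right g
  have ac := fun (f g : H →ₐ[k] H ⊗[k] H) => (hac.comp_left f).comp_right g
  have bc := fun (f g : H →ₐ[k] H ⊗[k] H) => (hbc.comp_left f).comp_right g
  simp only [ev_comulPair_elt, conv_comp_inl, conv_comp_inr]
  rw [hR.ev_conv_left _ _ _ (ab _ _) (ac _ _) (bc _ _),
    hR.ev_conv_right _ _ _ (ab _ _) (ac _ _) (bc _ _)]
  have h := commute_ev_ev (ab (inr k H H) (inl k H H)) (bc (inr k H H) (inl k H H))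
    (ab _ _) (ac _ _) (commHom_comp_inl_inr b) (bc _ _) R R
  simp only [mul_inv_rev, ← mul_assoc]
  rw [h.inv_inv]

/-- The two sides involve a_l * a_r * b_l * b_r and a_l * b_l * a_r * b_r. They differ by a swap of
the middle pair, which R(a_r, b_l)⁻¹ implements while commuting with a_l and b_r. -/
theorem comulPair_conv_mul (hR : IsTriangular R) (a b : H ⊗[k] H →ₐ[k] A) (h : CommHom a b)
    (x : H) :
    conv (a.comp (comulPair R).hom) (b.comp (comulPair R).hom)
        ((h.comp_left _).comp_right _) x * ev a b h (comulPair R).elt =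
      ev a b h (comulPair R).elt * conv a b h ((comulPair R).hom x) := by
  have ab := fun (f g : H →ₐ[k] H ⊗[k] H) => (h.comp_left f).comp_right g
  have ha := commHom_comp_inl_inr a
  have hb := commHom_comp_inl_inr b
  have e : conv a b h ((comulPair R).hom x) = ((conv a b h).comp (comulPair R).hom) x := rfl
  rw [e, ev_comulPair_elt]
  simp only [comp_comulPair, conv_comp_inl, conv_comp_inr]
  rw [conv_conv_conv _ _ _ _ ha (ab _ _) (ab _ _) (ab _ _) (ab _ _) hb,
    conv_conv_conv _ _ _ _ (ab _ _) ha (ab _ _) (ab _ _).symm hb (ab _ _)]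
  refine lift_mul_right_of_conj
    (CommHom.conv_right _ (CommHom.conv_right (ab _ _) ha (ab _ _)) (ab _ _))
    (CommHom.conv_right _ (CommHom.conv_right (ab _ _).symm (ab _ _) ha) (ab _ _)) _
    (fun y => ?_) (fun y => ?_) _
  · refine lift_mul_left_of_conj ((ab _ _).conv_left (ab _ _) hb)
      ((ab _ _).symm.conv_left hb (ab _ _)) _ (fun z => ?_) (fun z => ?_) _
    · rw [Units.mul_inv_eq_iff_eq_mul, mul_assoc, Units.eq_inv_mul_iff_mul_eq]
      exact (hR.conv_swap_mul _ _ (ab _ _) z).symm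
    · rw [← ev_inv]
      exact commute_hom_ev _ (ab _ _) hb _ _
  · rw [← ev_inv]
    exact commute_hom_ev _ ha.symm (ab _ _).symm _ _

theorem isTwCellData_comulPair (hR : IsTriangular R) : IsTwCellData (comulPair R) := by
  refine .of_legs (.of_legs (comulPair_cocycle hR _ _ _ commHom_leg₁₂ commHom_leg₁₃ commHom_leg₂₃)
    ?_ ?_) (comulPair_conv_mul hR _ _ _) ?_
  · simp only [ev_comulPair_elt, convUnit_comp_inr, hR.ev_counit_left, inv_one]
  · simp only [ev_comulPair_elt, convUnit_comp_inl, hR.ev_counit_right, inv_one]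
  · simp only [comp_comulPair, convUnit_comp_inl, convUnit_comp_inr, conv_convUnit_left]

/-- By the hexagons R(a_l * a_r, b_l * b_r) = R(a_l, b_r) R(a_l, b_l) R(a_r, b_r) R(a_r, b_l). The
middle two factors form the R-matrix of the tensor square, and the outer two are the twist terms.
The first of these appears there as R(b_r, a_l)⁻¹, so R⁻¹ = R^op is essential. -/
theorem isTwTrCell_comulPair (hR : IsTriangular R) :
    IsTwTrCell R (middle R R) (comulPair R) := by
  refine .of_legs (isTwCellData_comulPair hR) ?_
  have key : ∀ {A : Type _} [Ring A] [Algebra k A] (a b : H ⊗[k] H →ₐ[k] A) (h : CommHom a b),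
      ev (a.comp (comulPair R).hom) (b.comp (comulPair R).hom) ((h.comp_left _).comp_right _) R =
        ev b a h.symm (comulPair R).elt * ev a b h (middle R R) *
          (ev a b h (comulPair R).elt)⁻¹ := by
    intro A _ _ a b h
    have ab := fun (f g : H →ₐ[k] H ⊗[k] H) => (h.comp_left f).comp_right g
    have ha := commHom_comp_inl_inr a
    have hb := commHom_comp_inl_inr b
    simp only [comp_comulPair, ev_comulPair_elt, ev_middle]
    rw [hR.ev_conv_left _ _ _ ha (hb.conv_right (ab _ _) (ab _ _))
        (hb.conv_right (ab _ _) (ab _ _)), hR.ev_conv_right _ _ _ (ab _ _) (ab _ _) hb,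
      hR.ev_conv_right _ _ _ (ab _ _) (ab _ _) hb, hR.ev_swap _ _ (ab _ _), inv_inv, inv_inv]
    simp only [mul_assoc]
  exact key _ _ _

end Comul

/-! ### Diagonals -/

section Diagonal

variable {H : Type*} [Ring H] [Bialgebra k H]
variable {H₁ : Type*} [Ring H₁] [Bialgebra k H₁]
variable {H₂ : Type*} [Ring H₂] [Bialgebra k H₂]

/-- The factorisation reduces diagonals to composition, tensor products and the single 1-cell given
by Δ. -/
theorem diagonal_eq_comp (R : (H ⊗[k] H)ˣ) (p₁ : Pair k H H₁) (p₂ : Pair k H H₂) :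
    diagonal R p₁ p₂ = (p₁.tensor p₂).comp (comulPair R) := by
  have h : ((TwTr.inner : H₂ ⊗[k] H₁ →ₐ[k] (H₁ ⊗[k] H₂) ⊗[k] (H₁ ⊗[k] H₂)).comp
      (Algebra.TensorProduct.map p₂.hom p₁.hom)) =
      (Algebra.TensorProduct.map (p₁.tensor p₂).hom (p₁.tensor p₂).hom).comp
        (Algebra.TensorProduct.map (inr k H H) (inl k H H)) := by
    ext <;> simp [TwTr.inner, Pair.tensor]
  refine Pair.ext rfl (Units.ext ?_)
  exact congrArg (fun g : H ⊗[k] H →ₐ[k] (H₁ ⊗[k] H₂) ⊗[k] (H₁ ⊗[k] H₂) =>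
    g (R⁻¹ : (H ⊗[k] H)ˣ) * (middle p₁.elt p₂.elt : (H₁ ⊗[k] H₂) ⊗[k] (H₁ ⊗[k] H₂))) h

theorem IsTwTrCell.diagonal {R : (H ⊗[k] H)ˣ} {R₁ : (H₁ ⊗[k] H₁)ˣ} {R₂ : (H₂ ⊗[k] H₂)ˣ}
    (hR : IsTriangular R) {p₁ : Pair k H H₁} {p₂ : Pair k H H₂} (h₁ : IsTwTrCell R R₁ p₁)
    (h₂ : IsTwTrCell R R₂ p₂) : IsTwTrCell R (middle R₁ R₂) (diagonal R p₁ p₂) := by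
  rw [diagonal_eq_comp]
  exact (h₁.tensor h₂).comp (isTwTrCell_comulPair hR)

/-- Up to conjugation by an invertible element, the diagonal of the two components of a twisted
morphism into a tensor product is the given morphism. -/
theorem diagonal_proj_bijective (R : (H ⊗[k] H)ˣ) {p : Pair k H (H₁ ⊗[k] H₂)}
    (hp : IsTwCellData p) (hb : Function.Bijective p.hom) :
    Function.Bijective
      (diagonal R ((projLeft k H₁ H₂).comp p) ((projRight k H₁ H₂).comp p)).hom := by
  set a := (inl k H₁ H₂).comp (projLeft k H₁ H₂).hom
  set b := (inr k H₁ H₂).comp (projRight k H₁ H₂).hom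
  have hab : CommHom a b := (commHom_inl_inr.comp_left _).comp_right _
  have h : ∀ x, (diagonal R ((projLeft k H₁ H₂).comp p) ((projRight k H₁ H₂).comp p)).hom x =
      ev a b hab p.elt * p.hom x * ((ev a b hab p.elt)⁻¹ : (H₁ ⊗[k] H₂)ˣ) := by
    intro x
    rw [Units.eq_mul_inv_iff_mul_eq]
    -- The algebra map of the diagonal is (a f) * (b f), while a * b = Id; compatibility of f with Δ
    -- at (a, b) therefore says that F(a, b) conjugates f into the diagonal.
    have h1 := hp.conv_mul a b hab x
    rw [show conv a b hab = AlgHom.id k (H₁ ⊗[k] H₂) from conv_proj] at h1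
    refine Eq.trans (congrArg (· * _) ?_) h1
    have h2 := DFunLike.congr_fun (lift_comp_map (inl k H₁ H₂) (inr k H₁ H₂) commHom_inl_inr
      ((projLeft k H₁ H₂).hom.comp p.hom) ((projRight k H₁ H₂).hom.comp p.hom))
      (Bialgebra.comulAlgHom k H x)
    rw [lift_inl_inr] at h2
    exact h2
  have hc : Function.Bijective fun y : H₁ ⊗[k] H₂ =>
      ev a b hab p.elt * y * ((ev a b hab p.elt)⁻¹ : (H₁ ⊗[k] H₂)ˣ) := by
    refine Function.bijective_iff_has_inverse.2 ⟨fun y =>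
      ((ev a b hab p.elt)⁻¹ : (H₁ ⊗[k] H₂)ˣ) * y * ev a b hab p.elt, fun y => ?_, fun y => ?_⟩ <;>
    simp [mul_assoc]
  rw [show ⇑(diagonal R ((projLeft k H₁ H₂).comp p) ((projRight k H₁ H₂).comp p)).hom = _ from
    funext h]
  exact hc.comp hb

/-! ### The implications between the four conditions -/

variable {R : (H ⊗[k] H)ˣ} {R₁ : (H₁ ⊗[k] H₁)ˣ} {R₂ : (H₂ ⊗[k] H₂)ˣ}

theorem IsInvertibleTwTrCell.bijective {H' : Type*} [Ring H'] [Bialgebra k H']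
    {R' : (H' ⊗[k] H')ˣ} {p : Pair k H H'} (hp : IsInvertibleTwTrCell R R' p) :
    Function.Bijective p.hom := by
  obtain ⟨-, q, -, h1, h2⟩ := hp
  exact Function.bijective_iff_has_inverse.2 ⟨q.hom,
    fun x => DFunLike.congr_fun (congrArg Pair.hom h1) x,
    fun x => DFunLike.congr_fun (congrArg Pair.hom h2) x⟩

/-- The components of the given 1-cell serve as (f₁, F₁) and (f₂, F₂). They are surjective, and
their diagonal, though in general not the given 1-cell, has a bijective algebra map. -/
theorem HasInvertibleCell.hasInvertibleDiagonal (hR : IsTriangular R) (hR₁ : IsTriangular R₁)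
    (hR₂ : IsTriangular R₂) (h : HasInvertibleCell R R₁ R₂) : HasInvertibleDiagonal R R₁ R₂ := by
  obtain ⟨p, hp⟩ := h
  have h₁ := (isTwTrCell_projLeft R₁ hR₂).comp hp.1
  have h₂ := (isTwTrCell_projRight R₂ hR₁).comp hp.1
  exact ⟨_, _, h₁, projLeft_surjective.comp hp.bijective.2, h₂,
    projRight_surjective.comp hp.bijective.2,
    (h₁.diagonal hR h₂).isInvertible (diagonal_proj_bijective R hp.1.data hp.bijective)⟩

theorem HasInvertibleDiagonal.hasInvertibleCell (h : HasInvertibleDiagonal R R₁ R₂) :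
    HasInvertibleCell R R₁ R₂ := by
  obtain ⟨p₁, p₂, -, -, -, -, h⟩ := h
  exact ⟨_, h⟩

theorem hasInvertibleCell_iff_isTwistedTensorProduct :
    HasInvertibleCell R R₁ R₂ ↔ IsTwistedTensorProduct R R₁ R₂ := by
  constructor
  · rintro ⟨p, hp⟩
    obtain ⟨hF, f, hf, hfR⟩ := hp.1
    have hb : Function.Bijective f := by
      have : ⇑f = p.hom := funext fun x => DFunLike.congr_fun hf x
      rw [this]; exact hp.bijective
    refine ⟨p.elt, hF, BialgEquiv.ofBijective f hb, ?_⟩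
    have : ((BialgEquiv.ofBijective f hb : H ≃ₐc[k] Twisted hF) : H →ₐc[k] Twisted hF) = f :=
      BialgHom.ext fun _ => rfl
    rwa [this]
  · rintro ⟨F, hF, e, he⟩
    -- An isomorphism onto the twisted tensor product, read as a 1-cell with the same twist, has a
    -- bijective algebra map and is thus invertible.
    let p : Pair k H (H₁ ⊗[k] H₂) :=
      ⟨((Twisted.of hF).symm : Twisted hF →ₐ[k] H₁ ⊗[k] H₂).comp (e : H →ₐc[k] Twisted hF), F⟩
    have hp : IsTwTrCell R (middle R₁ R₂) p :=
      ⟨hF, (e : H →ₐc[k] Twisted hF), AlgHom.ext fun _ => rfl, he⟩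
    exact ⟨p, hp.isInvertible e.bijective⟩

theorem HasInvertibleDiagonal.hasDiagonalIso (h : HasInvertibleDiagonal R R₁ R₂) :
    HasDiagonalIso H₁ H₂ R := by
  obtain ⟨p₁, p₂, h₁, s₁, h₂, s₂, h⟩ := h
  obtain ⟨hF, f, hf, -⟩ := h.1
  have hb : Function.Bijective f := by
    have : ⇑f = (diagonal R p₁ p₂).hom := funext fun x => DFunLike.congr_fun hf x
    rw [this]; exact h.bijective
  exact ⟨p₁, p₂, isTwCell_iff.2 h₁.data, s₁, isTwCell_iff.2 h₂.data, s₂, hF,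
    BialgEquiv.ofBijective f hb, AlgHom.ext fun x => DFunLike.congr_fun hf x⟩

/-- The structures Rᵢ are the only ones for which (fᵢ, Fᵢ) can be 1-cells of triangular bialgebras.
With them the diagonal is automatically such a 1-cell, so only bijectivity of the given isomorphism
is needed. -/
theorem HasDiagonalIso.exists_hasInvertibleDiagonal (hR : IsTriangular R)
    (h : HasDiagonalIso H₁ H₂ R) :
    ∃ (R₁ : (H₁ ⊗[k] H₁)ˣ) (R₂ : (H₂ ⊗[k] H₂)ˣ),
      IsTriangular R₁ ∧ IsTriangular R₂ ∧ HasInvertibleDiagonal R R₁ R₂ := by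
  obtain ⟨p₁, p₂, h₁, s₁, h₂, s₂, hF, e, he⟩ := h
  rw [isTwCell_iff] at h₁ h₂
  have c₁ := h₁.isTwTrCell_push R
  have c₂ := h₂.isTwTrCell_push R
  refine ⟨p₁.push R, p₂.push R, h₁.isTriangular_push s₁ hR, h₂.isTriangular_push s₂ hR,
    p₁, p₂, c₁, s₁, c₂, s₂, (c₁.diagonal hR c₂).isInvertible ?_⟩
  have : ⇑e = (diagonal R p₁ p₂).hom := funext fun x => DFunLike.congr_fun he x
  rw [← this]
  exact e.bijective

end Diagonal

end TwTr

end

/-! ### The theorem, with quantified and with given factors -/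

theorem mainTheorem12 {k : Type u} [Field k] {H : Type v} [Ring H] [Bialgebra k H]
    (R : (H ⊗[k] H)ˣ) (hR : TwTr.IsTriangular R) :
    List.TFAE [
      ∃ (H₁ H₂ : Type v) (_ : Ring H₁) (_ : Bialgebra k H₁) (_ : Ring H₂) (_ : Bialgebra k H₂)
        (R₁ : (H₁ ⊗[k] H₁)ˣ) (R₂ : (H₂ ⊗[k] H₂)ˣ),
        TwTr.IsTriangular R₁ ∧ TwTr.IsTriangular R₂ ∧ TwTr.HasInvertibleCell R R₁ R₂,
      ∃ (H₁ H₂ : Type v) (_ : Ring H₁) (_ : Bialgebra k H₁) (_ : Ring H₂) (_ : Bialgebra k H₂)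
        (R₁ : (H₁ ⊗[k] H₁)ˣ) (R₂ : (H₂ ⊗[k] H₂)ˣ),
        TwTr.IsTriangular R₁ ∧ TwTr.IsTriangular R₂ ∧ TwTr.HasInvertibleDiagonal R R₁ R₂,
      ∃ (H₁ H₂ : Type v) (_ : Ring H₁) (_ : Bialgebra k H₁) (_ : Ring H₂) (_ : Bialgebra k H₂)
        (R₁ : (H₁ ⊗[k] H₁)ˣ) (R₂ : (H₂ ⊗[k] H₂)ˣ),
        TwTr.IsTriangular R₁ ∧ TwTr.IsTriangular R₂ ∧ TwTr.IsTwistedTensorProduct R R₁ R₂,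
      ∃ (H₁ H₂ : Type v) (_ : Ring H₁) (_ : Bialgebra k H₁) (_ : Ring H₂) (_ : Bialgebra k H₂),
        TwTr.HasDiagonalIso H₁ H₂ R] ∧
    ∀ (H₁ H₂ : Type v) [Ring H₁] [Bialgebra k H₁] [Ring H₂] [Bialgebra k H₂],
      List.TFAE [
        ∃ (R₁ : (H₁ ⊗[k] H₁)ˣ) (R₂ : (H₂ ⊗[k] H₂)ˣ),
          TwTr.IsTriangular R₁ ∧ TwTr.IsTriangular R₂ ∧ TwTr.HasInvertibleCell R R₁ R₂,
        ∃ (R₁ : (H₁ ⊗[k] H₁)ˣ) (R₂ : (H₂ ⊗[k] H₂)ˣ),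
          TwTr.IsTriangular R₁ ∧ TwTr.IsTriangular R₂ ∧ TwTr.HasInvertibleDiagonal R R₁ R₂,
        ∃ (R₁ : (H₁ ⊗[k] H₁)ˣ) (R₂ : (H₂ ⊗[k] H₂)ˣ),
          TwTr.IsTriangular R₁ ∧ TwTr.IsTriangular R₂ ∧ TwTr.IsTwistedTensorProduct R R₁ R₂,
        TwTr.HasDiagonalIso H₁ H₂ R] ∧
      ∀ (R₁ : (H₁ ⊗[k] H₁)ˣ) (R₂ : (H₂ ⊗[k] H₂)ˣ),
        TwTr.IsTriangular R₁ → TwTr.IsTriangular R₂ →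
        List.TFAE [TwTr.HasInvertibleCell R R₁ R₂, TwTr.HasInvertibleDiagonal R R₁ R₂,
          TwTr.IsTwistedTensorProduct R R₁ R₂] := by
  -- For given factors the triangular structures are quantified inside; the equivalence with free
  -- factors follows with the same `H₁` and `H₂` throughout.
  have key : ∀ (H₁ H₂ : Type v) [Ring H₁] [Bialgebra k H₁] [Ring H₂] [Bialgebra k H₂],
      List.TFAE [
        ∃ (R₁ : (H₁ ⊗[k] H₁)ˣ) (R₂ : (H₂ ⊗[k] H₂)ˣ),
          TwTr.IsTriangular R₁ ∧ TwTr.IsTriangular R₂ ∧ TwTr.HasInvertibleCell R R₁ R₂,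
        ∃ (R₁ : (H₁ ⊗[k] H₁)ˣ) (R₂ : (H₂ ⊗[k] H₂)ˣ),
          TwTr.IsTriangular R₁ ∧ TwTr.IsTriangular R₂ ∧ TwTr.HasInvertibleDiagonal R R₁ R₂,
        ∃ (R₁ : (H₁ ⊗[k] H₁)ˣ) (R₂ : (H₂ ⊗[k] H₂)ˣ),
          TwTr.IsTriangular R₁ ∧ TwTr.IsTriangular R₂ ∧ TwTr.IsTwistedTensorProduct R R₁ R₂,
        TwTr.HasDiagonalIso H₁ H₂ R] := by
    intro H₁ H₂ _ _ _ _
    tfae_have 1 → 2 := fun ⟨R₁, R₂, h₁, h₂, h⟩ => ⟨R₁, R₂, h₁, h₂, h.hasInvertibleDiagonal hR h₁ h₂⟩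
    tfae_have 2 → 4 := fun ⟨_, _, _, _, h⟩ => h.hasDiagonalIso
    tfae_have 4 → 2 := fun h => h.exists_hasInvertibleDiagonal hR
    tfae_have 2 → 1 := fun ⟨R₁, R₂, h₁, h₂, h⟩ => ⟨R₁, R₂, h₁, h₂, h.hasInvertibleCell⟩
    tfae_have 1 ↔ 3 := by simp only [TwTr.hasInvertibleCell_iff_isTwistedTensorProduct]
    tfae_finish
  refine ⟨?_, fun H₁ H₂ _ _ _ _ => ⟨key H₁ H₂, fun R₁ R₂ h₁ h₂ => ?_⟩⟩
  · tfae_have 1 → 2 := fun ⟨H₁, H₂, i₁, i₂, i₃, i₄, h⟩ =>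
      ⟨H₁, H₂, i₁, i₂, i₃, i₄, ((key H₁ H₂).out 0 1).1 h⟩
    tfae_have 2 → 3 := fun ⟨H₁, H₂, i₁, i₂, i₃, i₄, h⟩ =>
      ⟨H₁, H₂, i₁, i₂, i₃, i₄, ((key H₁ H₂).out 1 2).1 h⟩
    tfae_have 3 → 4 := fun ⟨H₁, H₂, i₁, i₂, i₃, i₄, h⟩ =>
      ⟨H₁, H₂, i₁, i₂, i₃, i₄, ((key H₁ H₂).out 2 3).1 h⟩
    tfae_have 4 → 1 := fun ⟨H₁, H₂, i₁, i₂, i₃, i₄, h⟩ =>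
      ⟨H₁, H₂, i₁, i₂, i₃, i₄, ((key H₁ H₂).out 3 0).1 h⟩
    tfae_finish
  · tfae_have 1 → 2 := fun h => h.hasInvertibleDiagonal hR h₁ h₂
    tfae_have 2 → 1 := fun h => h.hasInvertibleCell
    tfae_have 1 ↔ 3 := TwTr.hasInvertibleCell_iff_isTwistedTensorProduct
    tfae_finish
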